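/- Let $k$ be an algebraically closed field of characteristic zero. Let $$A=A(z^2)=k[z]\langle x,y\rangle\big/\bigl(xz=(z+1)x,\; yz=(z-1)y,\; xy=z^2,\; yx=(z-1)^2\bigr)$$ be the generalized Weyl algebra with defining element $f=z^2$, $\mathbb Z$-graded by $\deg x=1$, $\deg y=-1$, $\deg z=0$. For an abelian group $\Gamma$ and a $\Gamma$-graded $k$-algebra $R$, let $\operatorname{gr}(R,\Gamma)$ be the category of finitely generated $\Gamma$-graded right $R$-modules with degree-preserving homomorphisms; write $\operatorname{gr}A=\operatorname{gr}(A,\mathbb Z)$ and let $M\langle n\rangle$ denote the shift $M\langle n\rangle_i=M_{i-n}$. Let $\mathbb Z_{\mathrm{fin}}$ be the group of finite subsets of $\mathbb Z$ under symmetric difference $\oplus$. For $n\in\mathbb Z$ and a rank one graded projective right $A$-module $P$, let $\iota_nP\subseteq P$ be the common kernel of all degree-preserving homomorphisms from $P$ to $(A/xA)\langle n\rangle$ and to $(A/yA)\langle n+1\rangle$ (equivalently, the kernel of a surjection of $P$ onto one of these two modules; $P$ surjects onto exactly one of them). It is again a rank one graded projective, and $\iota_n$ acts on morphisms by restriction.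 (This is the restriction to rank one projectives of the autoequivalence of $\operatorname{gr}A$ that exchanges the simple modules $X\langle n\rangle$ and $Y\langle n\rangle$, where $X=A/(x,z)A$ and $Y=(A/(y,z-1)A)\langle 1\rangle$, and fixes all other simple modules up to isomorphism.) For $J\in\mathbb Z_{\mathrm{fin}}$ put $\iota_J=\prod_{j\in J}\iota_j$, with $\iota_\emptyset=\mathrm{Id}$, and $h_J=\prod_{j\in J}(z+j)^2$, and let $\sigma_J:\iota_J^2A\to A$ be the isomorphism given by left multiplication by $h_J^{-1}$. Let $$B=\bigoplus_{J\in\mathbb Z_{\mathrm{fin}}}B_J,\qquad B_J=\operatorname{Hom}_{\operatorname{gr}A}(A,\iota_JA),$$ be the $\mathbb Z_{\mathrm{fin}}$-graded $k$-algebra whose multiplication is, for $a\in B_I$ and $b\in B_J$, $$a\cdot b=\iota_{I\oplus J}(\sigma_{I\cap J})\circ\iota_J(a)\circ b\;\in\;B_{I\oplus J},$$ where $\iota_J\iota_IA$ is identified with $\iota_{I\oplus J}\iota_{I\cap J}^2A$. Then there is a $k$-linear equivalence of categories $$\operatorname{gr}A\;\equiv\;\operatorname{gr}(B,\mathbb Z_{\mathrm{fin}}).$$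 -/

import Mathlib

open CategoryTheory DirectSum

universe u

noncomputable section

namespace GWA

/-! ### Graded right modules -/

/-- A criterion for a family of subspaces to be a direct sum decomposition: they span, and there
are projections onto them. -/
theorem isInternal_of_proj {k M : Type u} {Γ : Type} [Field k] [DecidableEq Γ]
    [AddCommGroup M] [Module k M] (d : Γ → Submodule k M)
    (π : Γ → M →ₗ[k] M) (h1 : ∀ γ, ∀ m ∈ d γ, π γ m = m)
    (h2 : ∀ γ δ, γ ≠ δ → ∀ m ∈ d δ, π γ m = 0) (h3 : ⨆ γ, d γ = ⊤) : DirectSum.IsInternal d := by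
  rw [DirectSum.isInternal_submodule_iff_iSupIndep_and_iSup_eq_top]
  refine ⟨fun γ => ?_, h3⟩
  rw [Submodule.disjoint_def]
  intro m hm hm'
  have : (⨆ j, ⨆ (_ : j ≠ γ), d j) ≤ LinearMap.ker (π γ) :=
    iSup_le fun j => iSup_le fun hj => fun x hx => h2 γ j (Ne.symm hj) x hx
  rw [← h1 γ m hm]
  exact this hm'

section GradedModules

variable {k : Type u} [Field k] {Γ : Type} [AddCommGroup Γ] [DecidableEq Γ]
  {R : Type u} [Ring R] [Algebra k R]

/-- A `Γ`-graded right module over a `k`-algebra `R` graded by the subspaces `𝒜 γ`: a right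
`R`-module `M` (a module over the opposite ring), with a decomposition of `M` as the internal
direct sum of `k`-subspaces `deg γ` such that `M_γ · R_δ ⊆ M_{γ+δ}`. -/
structure GrMod (𝒜 : Γ → Submodule k R) : Type (u + 1) where
  carrier : Type u
  [addCommGroup : AddCommGroup carrier]
  [moduleBase : Module k carrier]
  [moduleRight : Module Rᵐᵒᵖ carrier]
  [isScalarTower : IsScalarTower k Rᵐᵒᵖ carrier]
  deg : Γ → Submodule k carrier
  isInternal : DirectSum.IsInternal deg
  smul_mem : ∀ {γ δ : Γ} {m : carrier} {r : R},
    m ∈ deg γ → r ∈ 𝒜 δ → MulOpposite.op r • m ∈ deg (γ + δ)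

attribute [instance] GrMod.addCommGroup GrMod.moduleBase GrMod.moduleRight GrMod.isScalarTower

namespace GrMod

variable {𝒜 : Γ → Submodule k R}

/-- The space of degree-preserving right `R`-module homomorphisms. -/
def homs (M N : GrMod 𝒜) : Submodule k (M.carrier →ₗ[Rᵐᵒᵖ] N.carrier) where
  carrier := {f | ∀ γ, ∀ m ∈ M.deg γ, f m ∈ N.deg γ}
  add_mem' hf hg γ m hm := (N.deg γ).add_mem (hf γ m hm) (hg γ m hm)
  zero_mem' γ _ _ := (N.deg γ).zero_mem
  smul_mem' c _ hf γ m hm := (N.deg γ).smul_mem c (hf γ m hm)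

/-- The category of all `Γ`-graded right `R`-modules, with degree-preserving homomorphisms. -/
instance : Category (GrMod 𝒜) where
  Hom M N := homs M N
  id M := ⟨LinearMap.id, fun _ _ hm => hm⟩
  comp f g := ⟨g.1.comp f.1, fun γ m hm => g.2 γ _ (f.2 γ m hm)⟩

instance (M N : GrMod 𝒜) : AddCommGroup (M ⟶ N) := inferInstanceAs (AddCommGroup (homs M N))

instance (M N : GrMod 𝒜) : Module k (M ⟶ N) := inferInstanceAs (Module k (homs M N))

/-- The `R`-linear map underlying a morphism of graded modules. -/
def toLin {M N : GrMod 𝒜} (f : M ⟶ N) : M.carrier →ₗ[Rᵐᵒᵖ] N.carrier := f.1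

theorem toLin_mem {M N : GrMod 𝒜} (f : M ⟶ N) {γ : Γ} {m : M.carrier} (hm : m ∈ M.deg γ) :
    toLin f m ∈ N.deg γ := f.2 γ m hm

/-- A degree-preserving linear map as a morphism. -/
def ofLin {M N : GrMod 𝒜} (f : M.carrier →ₗ[Rᵐᵒᵖ] N.carrier)
    (hf : ∀ γ, ∀ m ∈ M.deg γ, f m ∈ N.deg γ) : M ⟶ N := ⟨f, hf⟩

@[simp] theorem toLin_ofLin {M N : GrMod 𝒜} (f : M.carrier →ₗ[Rᵐᵒᵖ] N.carrier)
    (hf : ∀ γ, ∀ m ∈ M.deg γ, f m ∈ N.deg γ) : toLin (ofLin f hf) = f := rfl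

@[ext] theorem hom_ext {M N : GrMod 𝒜} {f g : M ⟶ N} (h : ∀ m, toLin f m = toLin g m) : f = g :=
  Subtype.ext (LinearMap.ext h)

@[simp] theorem toLin_id (M : GrMod 𝒜) (m : M.carrier) : toLin (𝟙 M) m = m := rfl

@[simp] theorem toLin_comp {L M N : GrMod 𝒜} (f : L ⟶ M) (g : M ⟶ N) (m : L.carrier) :
    toLin (f ≫ g) m = toLin g (toLin f m) := rfl

@[simp] theorem toLin_add {M N : GrMod 𝒜} (f g : M ⟶ N) (m : M.carrier) :
    toLin (f + g) m = toLin f m + toLin g m := rfl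

@[simp] theorem toLin_zero {M N : GrMod 𝒜} (m : M.carrier) :
    toLin (0 : M ⟶ N) m = 0 := rfl

@[simp] theorem toLin_smul {M N : GrMod 𝒜} (c : k) (f : M ⟶ N) (m : M.carrier) :
    toLin (c • f) m = c • toLin f m := rfl

instance : Preadditive (GrMod 𝒜) where
  add_comp _ _ _ f f' g := by ext m; simp
  comp_add _ _ _ f g g' := by ext m; simp

theorem toLin_smul_base {M N : GrMod 𝒜} (f : M ⟶ N) (c : k) (m : M.carrier) :
    toLin f (c • m) = c • toLin f m := by
  rw [← algebraMap_smul Rᵐᵒᵖ c m, map_smul, algebraMap_smul]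

instance : Linear k (GrMod 𝒜) where
  smul_comp _ _ _ r f g := by ext m; simp
  comp_smul _ _ _ f r g := by ext m; simp

/-- Finitely generated graded modules. -/
def finitelyGenerated (𝒜 : Γ → Submodule k R) : ObjectProperty (GrMod 𝒜) :=
  fun M => Module.Finite Rᵐᵒᵖ M.carrier

end GrMod

/-- The category `gr (R, Γ)` of finitely generated `Γ`-graded right `R`-modules. -/
abbrev Gr (𝒜 : Γ → Submodule k R) : Type (u + 1) := (GrMod.finitelyGenerated 𝒜).FullSubcategory

namespace GrMod

variable {𝒜 : Γ → Submodule k R}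

/-- The projection of a graded module onto its component of degree `γ`. -/
def proj (M : GrMod 𝒜) (γ : Γ) : M.carrier →ₗ[k] M.carrier :=
  letI := M.isInternal.chooseDecomposition
  (M.deg γ).subtype ∘ₗ DirectSum.component k Γ (fun i => M.deg i) γ ∘ₗ
    (DirectSum.decomposeLinearEquiv M.deg).toLinearMap

theorem proj_mem (M : GrMod 𝒜) (γ : Γ) (m : M.carrier) : M.proj γ m ∈ M.deg γ := by
  let := M.isInternal.chooseDecomposition
  exact ((DirectSum.decompose M.deg m) γ).2

theorem proj_same (M : GrMod 𝒜) {γ : Γ} {m : M.carrier} (hm : m ∈ M.deg γ) : M.proj γ m = m := by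
  let := M.isInternal.chooseDecomposition
  exact DirectSum.decompose_of_mem_same M.deg hm

theorem proj_ne (M : GrMod 𝒜) {γ δ : Γ} (h : γ ≠ δ) {m : M.carrier} (hm : m ∈ M.deg δ) :
    M.proj γ m = 0 := by
  let := M.isInternal.chooseDecomposition
  exact DirectSum.decompose_of_mem_ne M.deg hm (Ne.symm h)

theorem exists_sum_proj (M : GrMod 𝒜) (m : M.carrier) : ∃ s : Finset Γ, ∑ γ ∈ s, M.proj γ m = m := by
  let := M.isInternal.chooseDecomposition
  classical
  exact ⟨_, DirectSum.sum_support_decompose M.deg m⟩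

theorem iSup_deg (M : GrMod 𝒜) : ⨆ γ, M.deg γ = ⊤ := M.isInternal.submodule_iSup_eq_top

theorem proj_map {M N : GrMod 𝒜} (f : M ⟶ N) (γ : Γ) (m : M.carrier) :
    N.proj γ (toLin f m) = toLin f (M.proj γ m) := by
  obtain ⟨s, hs⟩ := M.exists_sum_proj m
  have key : ∀ δ, N.proj γ (toLin f (M.proj δ m)) = toLin f (M.proj γ (M.proj δ m)) := by
    intro δ
    by_cases h : γ = δ
    · subst h
      rw [M.proj_same (M.proj_mem γ m), N.proj_same (toLin_mem f (M.proj_mem γ m))]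
    · rw [M.proj_ne h (M.proj_mem δ m), N.proj_ne h (toLin_mem f (M.proj_mem δ m)), map_zero]
  conv_lhs => rw [← hs]
  conv_rhs => rw [← hs]
  simp only [map_sum, key]

/-- A submodule of a graded module is graded if it contains the homogeneous components of its
elements. -/
def IsGraded (M : GrMod 𝒜) (N : Submodule Rᵐᵒᵖ M.carrier) : Prop :=
  ∀ m ∈ N, ∀ γ, M.proj γ m ∈ N

/-- A graded submodule, as a graded module. -/
def sub (M : GrMod 𝒜) (N : Submodule Rᵐᵒᵖ M.carrier) (hN : M.IsGraded N) : GrMod 𝒜 where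
  carrier := N
  deg γ := (M.deg γ).comap (N.subtype.restrictScalars k)
  isInternal := by
    refine isInternal_of_proj _
      (fun γ => (M.proj γ).restrict (p := N.restrictScalars k) (q := N.restrictScalars k)
        fun m hm => hN m hm γ) ?_ ?_ ?_
    · intro γ m hm
      exact Subtype.ext (M.proj_same hm)
    · intro γ δ h m hm
      exact Subtype.ext (M.proj_ne h hm)
    · rw [eq_top_iff]
      intro m _
      obtain ⟨s, hs⟩ := M.exists_sum_proj m.1
      have : m = ∑ γ ∈ s, (⟨M.proj γ m.1, hN m.1 m.2 γ⟩ : N) := by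
        apply Subtype.ext
        rw [AddSubmonoidClass.coe_finsetSum]
        exact hs.symm
      rw [this]
      exact Submodule.sum_mem _ fun γ _ =>
        Submodule.mem_iSup_of_mem γ (M.proj_mem γ m.1)
  smul_mem hm hr := M.smul_mem hm hr

/-- The quotient of a graded module by a graded submodule. -/
def quot (M : GrMod 𝒜) (N : Submodule Rᵐᵒᵖ M.carrier) (hN : M.IsGraded N) : GrMod 𝒜 where
  carrier := M.carrier ⧸ N
  deg γ := (M.deg γ).map (N.mkQ.restrictScalars k)
  isInternal := by
    let e := Submodule.Quotient.restrictScalarsEquiv k N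
    let π : Γ → (M.carrier ⧸ N) →ₗ[k] (M.carrier ⧸ N) := fun γ =>
      e.toLinearMap ∘ₗ (Submodule.mapQ (N.restrictScalars k) (N.restrictScalars k) (M.proj γ)
        fun m hm => hN m hm γ) ∘ₗ e.symm.toLinearMap
    have hπ : ∀ γ m, π γ (N.mkQ m) = N.mkQ (M.proj γ m) := fun γ m => rfl
    refine isInternal_of_proj _ π ?_ ?_ ?_
    · rintro γ _ ⟨m, hm, rfl⟩
      exact (hπ γ m).trans (congrArg _ (M.proj_same hm))
    · rintro γ δ h _ ⟨m, hm, rfl⟩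
      exact (hπ γ m).trans ((congrArg _ (M.proj_ne h hm)).trans (map_zero _))
    · rw [← Submodule.map_iSup, M.iSup_deg, Submodule.map_top, LinearMap.range_eq_top]
      exact N.mkQ_surjective
  smul_mem := by
    rintro γ δ _ r ⟨m, hm, rfl⟩ hr
    exact ⟨MulOpposite.op r • m, M.smul_mem hm hr, rfl⟩

/-- The shifted module `M⟨δ⟩`, with `M⟨δ⟩_γ = M_{γ-δ}`. -/
def shift (δ : Γ) (M : GrMod 𝒜) : GrMod 𝒜 where
  carrier := M.carrier
  deg γ := M.deg (γ - δ)
  isInternal := by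
    refine isInternal_of_proj _ (fun γ => M.proj (γ - δ)) ?_ ?_ ?_
    · exact fun γ m hm => M.proj_same hm
    · exact fun γ ε h m hm => M.proj_ne (fun h' => h (sub_left_injective h')) hm
    · rw [eq_top_iff, ← M.iSup_deg]
      exact iSup_le fun γ => by
        simpa using le_iSup (fun ε => M.deg (ε - δ)) (γ + δ)
  smul_mem {γ ε m r} hm hr := by
    have := M.smul_mem hm hr
    rwa [sub_add_eq_add_sub] at this

/-- The algebra as a graded right module over itself. -/
def regular (𝒜 : Γ → Submodule k R) [GradedAlgebra 𝒜] : GrMod 𝒜 where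
  carrier := R
  deg := 𝒜
  isInternal := DirectSum.Decomposition.isInternal 𝒜
  smul_mem hm hr := SetLike.mul_mem_graded hm hr

/-- The right ideal generated by a homogeneous element is graded. -/
theorem isGraded_span_singleton [GradedAlgebra 𝒜] {ε : Γ} {w : R} (hw : w ∈ 𝒜 ε) :
    (regular 𝒜).IsGraded (Submodule.span Rᵐᵒᵖ {w}) := by
  intro m hm γ
  obtain ⟨r, rfl⟩ := Submodule.mem_span_singleton.1 hm
  let p : Γ → R →ₗ[k] R := (regular 𝒜).proj
  have pmem : ∀ γ r, p γ r ∈ 𝒜 γ := (regular 𝒜).proj_mem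
  have psame : ∀ {γ r}, r ∈ 𝒜 γ → p γ r = r := fun h => (regular 𝒜).proj_same h
  have pne : ∀ {γ δ r}, γ ≠ δ → r ∈ 𝒜 δ → p γ r = 0 := fun h h' => (regular 𝒜).proj_ne h h'
  have psum : ∃ s : Finset Γ, ∑ δ ∈ s, p δ r.unop = r.unop := (regular 𝒜).exists_sum_proj r.unop
  refine Submodule.mem_span_singleton.2 ⟨MulOpposite.op (p (γ - ε) r.unop), ?_⟩
  change w * p (γ - ε) r.unop = p γ (w * r.unop)
  obtain ⟨s, hs⟩ := psum
  have key : ∀ δ, w * p (γ - ε) (p δ r.unop) = p γ (w * p δ r.unop) := by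
    intro δ
    have hmem : w * p δ r.unop ∈ 𝒜 (ε + δ) := SetLike.mul_mem_graded hw (pmem δ r.unop)
    by_cases h : γ - ε = δ
    · have h' : γ = ε + δ := by rw [← h]; abel
      rw [h, psame (pmem δ _), h', psame hmem]
    · have h' : γ ≠ ε + δ := fun e => h (by rw [e]; abel)
      rw [pne h (pmem δ _), pne h' hmem, mul_zero]
  rw [← hs, map_sum, Finset.mul_sum, Finset.mul_sum, map_sum]
  exact Finset.sum_congr rfl fun δ _ => key δ

end GrMod

end GradedModules

/-! ### Generalized Weyl algebras -/

section Algebra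

open Polynomial

/-- The generators `x`, `y`, `z`. -/
inductive Gen : Type
  | x
  | y
  | z

/-- The grading of the generators: `deg x = 1`, `deg y = -1`, `deg z = 0`. -/
def Gen.degree : Gen → ℤ
  | .x => 1
  | .y => -1
  | .z => 0

variable {k : Type u} [Field k]

/-- The defining relations `x z = (z + 1) x`, `y z = (z - 1) y`, `x y = f(z)`, `y x = f(z - 1)`. -/
inductive Rel (f : k[X]) : FreeAlgebra k Gen → FreeAlgebra k Gen → Prop
  | xz : Rel f (FreeAlgebra.ι k Gen.x * FreeAlgebra.ι k Gen.z)
      ((FreeAlgebra.ι k Gen.z + 1) * FreeAlgebra.ι k Gen.x)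
  | yz : Rel f (FreeAlgebra.ι k Gen.y * FreeAlgebra.ι k Gen.z)
      ((FreeAlgebra.ι k Gen.z - 1) * FreeAlgebra.ι k Gen.y)
  | xy : Rel f (FreeAlgebra.ι k Gen.x * FreeAlgebra.ι k Gen.y)
      (aeval (FreeAlgebra.ι k Gen.z) f)
  | yx : Rel f (FreeAlgebra.ι k Gen.y * FreeAlgebra.ι k Gen.x)
      (aeval (FreeAlgebra.ι k Gen.z - 1) f)

/-- The generalized Weyl algebra `A(f)` over `k[z]` with automorphism `z ↦ z + 1`. -/
def A (f : k[X]) : Type u := RingQuot (Rel f)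

instance (f : k[X]) : Ring (A f) := inferInstanceAs (Ring (RingQuot (Rel f)))

instance (f : k[X]) : Algebra k (A f) := inferInstanceAs (Algebra k (RingQuot (Rel f)))

variable (f : k[X])

/-- The quotient map onto `A(f)`. -/
def quotMap : FreeAlgebra k Gen →ₐ[k] A f := RingQuot.mkAlgHom k (Rel f)

theorem quotMap_rel {a b : FreeAlgebra k Gen} (h : Rel f a b) : quotMap f a = quotMap f b :=
  RingQuot.mkAlgHom_rel k h

/-- The image of a generator in `A(f)`. -/
def gen (g : Gen) : A f := quotMap f (FreeAlgebra.ι k g)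

/-- The inclusion `k[z] → A(f)`. -/
def poly : k[X] →ₐ[k] A f := aeval (gen f .z)

/-- The component of degree `i` of `A(f)`: the span of the words of degree `i`. -/
def grading (i : ℤ) : Submodule k (A f) :=
  Submodule.span k {a | ∃ w : List Gen, (w.map Gen.degree).sum = i ∧ (w.map (gen f)).prod = a}

theorem word_mem (w : List Gen) : (w.map (gen f)).prod ∈ grading f (w.map Gen.degree).sum :=
  Submodule.subset_span ⟨w, rfl, rfl⟩

theorem gen_mem (g : Gen) : gen f g ∈ grading f g.degree := by
  simpa using word_mem f [g]

instance : SetLike.GradedMonoid (grading f) where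
  one_mem := by simpa using word_mem f []
  mul_mem := by
    intro i j a b ha hb
    have : grading f i * grading f j ≤ grading f (i + j) := by
      rw [grading, grading, Submodule.span_mul_span, Submodule.span_le]
      rintro _ ⟨_, ⟨w, rfl, rfl⟩, _, ⟨w', rfl, rfl⟩, rfl⟩
      simpa using word_mem f (w ++ w')
    exact this (Submodule.mul_mem_mul ha hb)

theorem gen_xz : gen f .x * gen f .z = (gen f .z + 1) * gen f .x := by
  have := quotMap_rel f Rel.xz
  rwa [map_mul, map_mul, map_add, map_one] at this

theorem gen_yz : gen f .y * gen f .z = (gen f .z - 1) * gen f .y := by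
  have := quotMap_rel f Rel.yz
  rwa [map_mul, map_mul, map_sub, map_one] at this

theorem gen_xy : gen f .x * gen f .y = aeval (gen f .z) f := by
  have := quotMap_rel f Rel.xy
  rwa [map_mul, ← aeval_algHom_apply] at this

theorem gen_yx : gen f .y * gen f .x = aeval (gen f .z - 1) f := by
  have := quotMap_rel f Rel.yx
  rwa [map_mul, ← aeval_algHom_apply, map_sub, map_one] at this

/-- A homomorphism out of `A(f)` from images of the generators satisfying the relations. -/
def liftA {S : Type u} [Ring S] [Algebra k S] (v : Gen → S)
    (h1 : v .x * v .z = (v .z + 1) * v .x) (h2 : v .y * v .z = (v .z - 1) * v .y)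
    (h3 : v .x * v .y = aeval (v .z) f) (h4 : v .y * v .x = aeval (v .z - 1) f) : A f →ₐ[k] S :=
  RingQuot.liftAlgHom k ⟨FreeAlgebra.lift k v, by
    intro a b h
    cases h with
    | xz => simpa using h1
    | yz => simpa using h2
    | xy => rw [map_mul, ← aeval_algHom_apply]; simpa using h3
    | yx => rw [map_mul, ← aeval_algHom_apply]; simpa using h4⟩

theorem liftA_gen {S : Type u} [Ring S] [Algebra k S] (v : Gen → S) (h1 h2 h3 h4) (g : Gen) :
    liftA f v h1 h2 h3 h4 (gen f g) = v g :=
  (RingQuot.liftAlgHom_mkAlgHom_apply k _ _ _).trans (FreeAlgebra.lift_ι_apply _ _)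

theorem A_hom_ext {S : Type u} [Ring S] [Algebra k S] {φ ψ : A f →ₐ[k] S}
    (h : ∀ g, φ (gen f g) = ψ (gen f g)) : φ = ψ := by
  refine RingQuot.ringQuot_ext' k _ _ ?_
  exact FreeAlgebra.hom_ext (funext h)

/-- The homogeneous generators in the direct sum of the components. -/
def homGen (g : Gen) : ⨁ i, grading f i :=
  DirectSum.of (fun i => grading f i) g.degree ⟨gen f g, gen_mem f g⟩

theorem poly_mem (p : k[X]) : poly f p ∈ grading f 0 := by
  have h : Algebra.adjoin k {gen f .z} ≤ SetLike.GradeZero.subalgebra (grading f) :=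
    Algebra.adjoin_le (Set.singleton_subset_iff.2 (gen_mem f .z))
  exact h (aeval_mem_adjoin_singleton k (gen f .z))

theorem of_eq {i j : ℤ} (h : i = j) {a b : A f} (h' : a = b) (ha : a ∈ grading f i)
    (hb : b ∈ grading f j) :
    DirectSum.of (fun i => grading f i) i ⟨a, ha⟩ =
      DirectSum.of (fun i => grading f i) j ⟨b, hb⟩ := by
  subst h; subst h'; rfl

/-- The inclusion of the component of degree `0`. -/
def zeroHom : SetLike.GradeZero.subalgebra (grading f) →ₐ[k] ⨁ i, grading f i where
  toFun a := DirectSum.of (fun i => grading f i) 0 ⟨a.1, a.2⟩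
  map_one' := rfl
  map_zero' := map_zero _
  map_add' a b := map_add (DirectSum.of (fun i => grading f i) 0) ⟨a.1, a.2⟩ ⟨b.1, b.2⟩
  map_mul' a b := by
    rw [DirectSum.of_mul_of]
    exact of_eq f (by simp) rfl _ _
  commutes' r := rfl

theorem aeval_of {a : A f} (ha : a ∈ grading f 0) (p : k[X]) (hp : aeval a p ∈ grading f 0) :
    aeval (DirectSum.of (fun i => grading f i) 0 ⟨a, ha⟩ : ⨁ i, grading f i) p =
      DirectSum.of (fun i => grading f i) 0 ⟨aeval a p, hp⟩ := by
  let a' : SetLike.GradeZero.subalgebra (grading f) := ⟨a, ha⟩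
  have h1 : aeval (zeroHom f a') p = zeroHom f (aeval a' p) := aeval_algHom_apply _ _ _
  have h2 : ((aeval a' p : SetLike.GradeZero.subalgebra (grading f)) : A f) = aeval a p :=
    (aeval_algHom_apply (SetLike.GradeZero.subalgebra (grading f)).val a' p).symm
  refine h1.trans ?_
  change DirectSum.of (fun i => grading f i) 0 ⟨_, _⟩ = _
  congr 2

theorem z_add_one_mem : gen f .z + 1 ∈ grading f 0 :=
  (grading f 0).add_mem (gen_mem f .z) SetLike.GradedOne.one_mem

theorem z_sub_one_mem : gen f .z - 1 ∈ grading f 0 :=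
  (grading f 0).sub_mem (gen_mem f .z) SetLike.GradedOne.one_mem

theorem homGen_z : homGen f .z = DirectSum.of (fun i => grading f i) 0 ⟨gen f .z, gen_mem f .z⟩ :=
  rfl

theorem homGen_add_one :
    homGen f .z + 1 = DirectSum.of (fun i => grading f i) 0 ⟨gen f .z + 1, z_add_one_mem f⟩ :=
  (map_add (DirectSum.of (fun i => grading f i) 0) ⟨_, gen_mem f .z⟩
    ⟨1, SetLike.GradedOne.one_mem⟩).symm

theorem homGen_sub_one :
    homGen f .z - 1 = DirectSum.of (fun i => grading f i) 0 ⟨gen f .z - 1, z_sub_one_mem f⟩ :=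
  (map_sub (DirectSum.of (fun i => grading f i) 0) ⟨_, gen_mem f .z⟩
    ⟨1, SetLike.GradedOne.one_mem⟩).symm

theorem homGen_xz : homGen f .x * homGen f .z = (homGen f .z + 1) * homGen f .x := by
  rw [homGen_add_one, homGen, homGen, DirectSum.of_mul_of, DirectSum.of_mul_of]
  exact of_eq f rfl (gen_xz f) _ _

theorem homGen_yz : homGen f .y * homGen f .z = (homGen f .z - 1) * homGen f .y := by
  rw [homGen_sub_one, homGen, homGen, DirectSum.of_mul_of, DirectSum.of_mul_of]
  exact of_eq f rfl (gen_yz f) _ _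

theorem homGen_xy : homGen f .x * homGen f .y = aeval (homGen f .z) f := by
  have hm : aeval (gen f .z) f ∈ grading f 0 := poly_mem f f
  rw [homGen_z, aeval_of f (gen_mem f .z) f hm, homGen, homGen, DirectSum.of_mul_of]
  exact of_eq f rfl (gen_xy f) _ _

theorem homGen_yx : homGen f .y * homGen f .x = aeval (homGen f .z - 1) f := by
  have hm : aeval (gen f .z - 1) f ∈ grading f 0 := by
    have h := SetLike.mul_mem_graded (gen_mem f .y) (gen_mem f .x)
    rwa [gen_yx f, show Gen.y.degree + Gen.x.degree = 0 from rfl] at h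
  rw [homGen_sub_one, aeval_of f (z_sub_one_mem f) f hm, homGen, homGen, DirectSum.of_mul_of]
  exact of_eq f rfl (gen_yx f) _ _

/-- The decomposition homomorphism. -/
def decompHom : A f →ₐ[k] ⨁ i, grading f i :=
  liftA f (homGen f) (homGen_xz f) (homGen_yz f) (homGen_xy f) (homGen_yx f)

instance : GradedAlgebra (grading f) :=
  GradedAlgebra.ofAlgHom (grading f) (decompHom f)
    (by
      refine A_hom_ext f fun g => ?_
      simp [decompHom, liftA_gen, homGen])
    (by
      have key : ∀ w : List Gen, ∀ h, decompHom f (w.map (gen f)).prod =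
          DirectSum.of (fun i => grading f i) (w.map Gen.degree).sum ⟨(w.map (gen f)).prod, h⟩ := by
        intro w
        induction w with
        | nil => intro h; exact map_one _
        | cons g w ih =>
          intro h
          have e : decompHom f (gen f g * (w.map (gen f)).prod) = _ :=
            (map_mul _ _ _).trans (congrArg₂ (· * ·) (liftA_gen f _ _ _ _ _ g) (ih (word_mem f w)))
          exact e.trans (DirectSum.of_mul_of _ _)
      rintro i ⟨a, ha⟩
      induction ha using Submodule.span_induction with
      | mem a h =>
        obtain ⟨w, rfl, rfl⟩ := h
        exact key w _
      | zero => exact (map_zero _).trans (map_zero _).symm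
      | add a b ha hb iha ihb =>
        exact (map_add _ _ _).trans ((congrArg₂ _ iha ihb).trans (map_add _ _ _).symm)
      | smul c a ha iha =>
        refine (map_smul (decompHom f) c a).trans ((congrArg _ iha).trans ?_)
        exact (DirectSum.lof k ℤ (fun i => grading f i) i).map_smul c ⟨a, ha⟩ |>.symm)

end Algebra

/-! ### Structure of the degree-zero part -/

section Structure

open Polynomial

variable {k : Type u} [Field k] (f : k[X])

theorem gen_mul_z (g : Gen) : gen f g * gen f .z = (gen f .z + algebraMap k (A f) g.degree) * gen f g := by
  cases g with
  | x => simpa [Gen.degree] using gen_xz f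
  | y => simpa [Gen.degree, sub_eq_add_neg] using gen_yz f
  | z => simp [Gen.degree]

theorem mul_z {i : ℤ} {a : A f} (ha : a ∈ grading f i) :
    a * gen f .z = (gen f .z + algebraMap k (A f) i) * a := by
  induction ha using Submodule.span_induction with
  | mem a h =>
    obtain ⟨w, rfl, rfl⟩ := h
    induction w with
    | nil => simp
    | cons g w ih =>
      simp only [List.map_cons, List.prod_cons, List.sum_cons]
      rw [mul_assoc, ih, ← mul_assoc, mul_add, gen_mul_z, ← Algebra.commutes, ← add_mul, mul_assoc,
        Int.cast_add, map_add, add_assoc]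
  | zero => simp
  | add a b _ _ iha ihb => rw [add_mul, iha, ihb, mul_add]
  | smul c a _ iha => rw [smul_mul_assoc, iha, mul_smul_comm]

theorem poly_comp (p : k[X]) (i : k) :
    poly f (p.comp (X + C i)) = aeval (gen f .z + algebraMap k (A f) i) p := by
  rw [poly, aeval_comp]; simp

theorem mul_poly {i : ℤ} {a : A f} (ha : a ∈ grading f i) (p : k[X]) :
    a * poly f p = poly f (p.comp (X + C (i : k))) * a := by
  have h : SemiconjBy a (gen f .z) (gen f .z + algebraMap k (A f) i) := mul_z f ha
  rw [poly_comp]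
  change a * aeval (gen f .z) p = _
  induction p using Polynomial.induction_on' with
  | add p q hp hq => rw [map_add, map_add, mul_add, add_mul, hp, hq]
  | monomial n c =>
    rw [aeval_monomial, aeval_monomial, ← mul_assoc, ← Algebra.commutes, mul_assoc,
      (h.pow_right n).eq, ← mul_assoc]

/-- The monomials `x ^ i` and `y ^ (-i)`. -/
def mon : ℤ → A f
  | Int.ofNat n => gen f .x ^ n
  | Int.negSucc n => gen f .y ^ (n + 1)

theorem gen_mul_mon (g : Gen) (i : ℤ) :
    ∃ p : k[X], gen f g * mon f i = poly f p * mon f (g.degree + i) := by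
  cases g with
  | z =>
    refine ⟨X, ?_⟩
    simp [Gen.degree, poly]
  | x =>
    cases i with
    | ofNat n =>
      refine ⟨1, ?_⟩
      rw [show Gen.x.degree + Int.ofNat n = Int.ofNat (n + 1) by simp [Gen.degree]; ring]
      simp [mon, pow_succ']
    | negSucc n =>
      refine ⟨f, ?_⟩
      have h : gen f .x * gen f .y ^ (n + 1) = poly f f * gen f .y ^ n := by
        rw [pow_succ', ← mul_assoc, gen_xy]; rfl
      cases n with
      | zero => simpa [mon, Gen.degree] using h
      | succ n =>
        rw [show Gen.x.degree + Int.negSucc (n + 1) = Int.negSucc n by simp [Gen.degree]; omega]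
        exact h
  | y =>
    cases i with
    | negSucc n =>
      refine ⟨1, ?_⟩
      rw [show Gen.y.degree + Int.negSucc n = Int.negSucc (n + 1) by simp [Gen.degree]; omega]
      simp [mon, pow_succ']
    | ofNat n =>
      cases n with
      | zero =>
        refine ⟨1, ?_⟩
        change gen f .y * gen f .x ^ 0 = poly f 1 * gen f .y ^ (0 + 1)
        simp
      | succ n =>
        refine ⟨f.comp (X + C (-1)), ?_⟩
        rw [show Gen.y.degree + Int.ofNat (n + 1) = Int.ofNat n by simp [Gen.degree]]
        rw [poly_comp]
        change gen f .y * gen f .x ^ (n + 1) = _ * gen f .x ^ n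
        rw [pow_succ', ← mul_assoc, gen_yx]
        simp [sub_eq_add_neg]

theorem exists_poly_mon {i : ℤ} {a : A f} (ha : a ∈ grading f i) :
    ∃ p : k[X], a = poly f p * mon f i := by
  induction ha using Submodule.span_induction with
  | mem a h =>
    obtain ⟨w, rfl, rfl⟩ := h
    induction w with
    | nil => exact ⟨1, by simp [mon]⟩
    | cons g w ih =>
      obtain ⟨p, hp⟩ := ih
      obtain ⟨q, hq⟩ := gen_mul_mon f g (w.map Gen.degree).sum
      refine ⟨p.comp (X + C (g.degree : k)) * q, ?_⟩
      rw [List.map_cons, List.prod_cons, hp, ← mul_assoc, mul_poly f (gen_mem f g), mul_assoc, hq,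
        map_mul, mul_assoc]
      rfl
  | zero => exact ⟨0, by simp⟩
  | add a b _ _ iha ihb =>
    obtain ⟨p, rfl⟩ := iha
    obtain ⟨q, rfl⟩ := ihb
    exact ⟨p + q, by rw [map_add, add_mul]⟩
  | smul c a _ iha =>
    obtain ⟨p, rfl⟩ := iha
    exact ⟨c • p, by rw [map_smul, smul_mul_assoc]⟩

theorem exists_poly {a : A f} (ha : a ∈ grading f 0) : ∃ p : k[X], poly f p = a := by
  obtain ⟨p, hp⟩ := exists_poly_mon f ha
  exact ⟨p, by simpa [mon] using hp.symm⟩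

/-- Multiplication by a polynomial on `k[z]`. -/
def mulL (p : k[X]) : Module.End k k[X] := Algebra.lmul k k[X] p

@[simp] theorem mulL_apply (p q : k[X]) : mulL p q = p * q := rfl

theorem aeval_mulL (p q : k[X]) : aeval (mulL q) p = mulL (p.comp q) := by
  rw [mulL, aeval_algHom_apply]; rfl

theorem mulL_X_sub_one : mulL (X : k[X]) - 1 = mulL (X - 1) :=
  LinearMap.ext fun p => by simp [sub_mul]

/-- The representation of `A(f)` on `k[z]` with `x` acting as `f(z) τ` and `y` as `τ⁻¹`, where `τ`
is the translation `p(z) ↦ p(z + 1)`. -/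
def rep₁ : A f →ₐ[k] Module.End k k[X] :=
  liftA f (fun g => match g with
    | .x => mulL f * taylor 1
    | .y => taylor (-1)
    | .z => mulL X)
    (LinearMap.ext fun p => by simp [taylor_mul]; ring)
    (LinearMap.ext fun p => by simp [taylor_mul]; ring)
    (by rw [aeval_mulL]; exact LinearMap.ext fun p => by simp [taylor_taylor])
    (by
      dsimp only
      rw [mulL_X_sub_one, aeval_mulL]
      exact LinearMap.ext fun p => by
        simp [taylor_taylor, taylor_mul]; simp [taylor_apply, sub_eq_add_neg])

/-- The representation of `A(f)` on `k[z]` with `x` acting as `τ` and `y` as `τ⁻¹ f(z)`. -/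
def rep₂ : A f →ₐ[k] Module.End k k[X] :=
  liftA f (fun g => match g with
    | .x => taylor 1
    | .y => taylor (-1) * mulL f
    | .z => mulL X)
    (LinearMap.ext fun p => by simp [taylor_mul]; ring)
    (LinearMap.ext fun p => by simp [taylor_mul]; ring)
    (by rw [aeval_mulL]; exact LinearMap.ext fun p => by simp [taylor_taylor])
    (by
      dsimp only
      rw [mulL_X_sub_one, aeval_mulL]
      exact LinearMap.ext fun p => by
        simp [taylor_taylor, taylor_mul]; simp [taylor_apply, sub_eq_add_neg])

theorem rep₁_poly (p : k[X]) : rep₁ f (poly f p) = mulL p := by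
  rw [poly, ← aeval_algHom_apply, rep₁, liftA_gen, aeval_mulL, comp_X]

theorem rep₂_poly (p : k[X]) : rep₂ f (poly f p) = mulL p := by
  rw [poly, ← aeval_algHom_apply, rep₂, liftA_gen, aeval_mulL, comp_X]

theorem poly_injective : Function.Injective (poly f) := by
  intro p q h
  have := congrArg (fun a => rep₁ f a 1) h
  simpa [rep₁_poly] using this

theorem taylor_pow_apply (c : k) (n : ℕ) (p : k[X]) :
    (taylor c ^ n : Module.End k k[X]) p = taylor (n * c) p := by
  induction n with
  | zero => simp
  | succ n ih =>
    rw [pow_succ', Module.End.mul_apply, ih, taylor_taylor]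
    push_cast
    congr 2
    ring

/-- If `y ^ n p(z)` lies in the right ideal generated by `x`, then `f(z)` divides `p(z - n)`. -/
theorem dvd_of_mem_x {n : ℕ} {p : k[X]} {b : A f} (h : gen f .y ^ n * poly f p = gen f .x * b) :
    f ∣ p.comp (X - C (n : k)) := by
  have h' := congrArg (fun a => rep₁ f a 1) h
  simp only [map_mul, map_pow, rep₁_poly] at h'
  simp only [rep₁, liftA_gen, Module.End.mul_apply, taylor_pow_apply, mulL_apply, mul_one] at h'
  rw [taylor_apply] at h'
  refine ⟨_, Eq.trans ?_ h'⟩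
  simp [sub_eq_add_neg]

/-- If `x ^ n p(z)` lies in the right ideal generated by `y`, then `f(z - 1)` divides
`p(z + n)`. -/
theorem dvd_of_mem_y {n : ℕ} {p : k[X]} {b : A f} (h : gen f .x ^ n * poly f p = gen f .y * b) :
    f.comp (X - C 1) ∣ p.comp (X + C (n : k)) := by
  have h' := congrArg (fun a => rep₂ f a 1) h
  simp only [map_mul, map_pow, rep₂_poly] at h'
  simp only [rep₂, liftA_gen, Module.End.mul_apply, taylor_pow_apply, mulL_apply, mul_one,
    taylor_mul] at h'
  rw [taylor_apply, taylor_apply] at h'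
  rw [sub_eq_add_neg, ← C_neg]
  exact ⟨_, h'⟩

end Structure

/-! ### The involutions -/

section Involutions

open Polynomial

variable (k : Type u) [Field k]

/-- The grading of `A(z²)`. -/
abbrev gradA : ℤ → Submodule k (A (X ^ 2 : k[X])) := grading (X ^ 2)

/-- `A = A(z²)` as a graded right module over itself. -/
abbrev modA : GrMod (gradA k) := GrMod.regular (gradA k)

/-- The right ideal of `A(z²)` generated by one of the generators. -/
def rightIdeal (g : Gen) : Submodule (A (X ^ 2 : k[X]))ᵐᵒᵖ (A (X ^ 2 : k[X])) :=
  Submodule.span _ {gen (X ^ 2) g}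

/-- The graded module `A/xA`, the nonsplit self-extension of the simple module
`X = A/(x,z)A`. -/
def quotX : GrMod (gradA k) :=
  (modA k).quot (rightIdeal k .x) (GrMod.isGraded_span_singleton (gen_mem _ .x))

/-- The graded module `A/yA`; its shift `A/yA⟨1⟩` is the nonsplit self-extension of the simple
module `Y = (A/(y,z-1)A)⟨1⟩`. -/
def quotY : GrMod (gradA k) :=
  (modA k).quot (rightIdeal k .y) (GrMod.isGraded_span_singleton (gen_mem _ .y))

variable {k}

/-- The submodule `ι_n P` of `P`: the common kernel of all morphisms from `P` to `A/xA⟨n⟩` and to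
`A/yA⟨n+1⟩`. A rank one graded projective `P` surjects onto exactly one of these two modules, has
no nonzero morphism to the other one, and every morphism to the former factors through a fixed
surjection; so `ι_n P` is the kernel of a surjection of `P` onto `A/xA⟨n⟩` or `A/yA⟨n+1⟩`. -/
def iotaSub (n : ℤ) (P : GrMod (gradA k)) : Submodule (A (X ^ 2 : k[X]))ᵐᵒᵖ P.carrier :=
  (⨅ φ : P ⟶ (quotX k).shift n, LinearMap.ker (GrMod.toLin φ)) ⊓
    ⨅ ψ : P ⟶ (quotY k).shift (n + 1), LinearMap.ker (GrMod.toLin ψ)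

theorem mem_iotaSub {n : ℤ} {P : GrMod (gradA k)} {m : P.carrier} :
    m ∈ iotaSub n P ↔ (∀ φ : P ⟶ (quotX k).shift n, GrMod.toLin φ m = 0) ∧
      ∀ ψ : P ⟶ (quotY k).shift (n + 1), GrMod.toLin ψ m = 0 := by
  simp only [iotaSub, Submodule.mem_inf, Submodule.mem_iInf, LinearMap.mem_ker]

theorem isGraded_iotaSub (n : ℤ) (P : GrMod (gradA k)) : P.IsGraded (iotaSub n P) := by
  intro m hm i
  rw [mem_iotaSub] at hm ⊢
  exact ⟨fun φ => by rw [← GrMod.proj_map, hm.1 φ, map_zero],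
    fun ψ => by rw [← GrMod.proj_map, hm.2 ψ, map_zero]⟩

theorem map_mem_iotaSub (n : ℤ) {P Q : GrMod (gradA k)} (g : P ⟶ Q) {m : P.carrier}
    (hm : m ∈ iotaSub n P) : GrMod.toLin g m ∈ iotaSub n Q := by
  rw [mem_iotaSub] at hm ⊢
  exact ⟨fun φ => hm.1 (g ≫ φ), fun ψ => hm.2 (g ≫ ψ)⟩

/-- The involution `ι_n`, as a subfunctor of the identity: it acts on morphisms by restriction.
The modules that enter the construction of `B` are obtained from `A` by iterating these functors;
they are rank one graded projectives, and on such modules `ι_n` is the numerically trivial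
autoequivalence of `gr A` exchanging `X⟨n⟩` and `Y⟨n⟩` and fixing all other simple modules. That
autoequivalence is determined up to isomorphism by its restriction to the rank one graded
projectives, being exact. -/
def iota (n : ℤ) : GrMod (gradA k) ⥤ GrMod (gradA k) where
  obj P := P.sub (iotaSub n P) (isGraded_iotaSub n P)
  map {P Q} g := GrMod.ofLin
    ((GrMod.toLin g).restrict fun _ hm => map_mem_iotaSub n g hm)
    fun _ _ hm => GrMod.toLin_mem g hm

/-- The inclusion of `ι_n` into the identity functor. -/
def iotaIncl (n : ℤ) : iota (k := k) n ⟶ 𝟭 (GrMod (gradA k)) where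
  app P := GrMod.ofLin (iotaSub n P).subtype fun _ _ hm => hm

/-- The composition `ι_{j₁} ι_{j₂} ⋯ ι_{jᵣ}`. -/
def iotaList : List ℤ → (GrMod (gradA k) ⥤ GrMod (gradA k))
  | [] => 𝟭 _
  | j :: l => iotaList l ⋙ iota j

/-- The inclusion of `ι_{j₁} ι_{j₂} ⋯ ι_{jᵣ}` into the identity functor. -/
def iotaListIncl : (l : List ℤ) → (iotaList (k := k) l ⟶ 𝟭 (GrMod (gradA k)))
  | [] => 𝟙 _
  | j :: l => Functor.whiskerLeft (iotaList l) (iotaIncl j) ≫ iotaListIncl l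

variable (k)

/-- The group `ℤ_fin` of finite subsets of `ℤ` with symmetric difference as addition. (The
multiplication of the type `AsBoolRing` is the intersection.) -/
abbrev Zfin : Type := AsBoolRing (Finset ℤ)

instance : DecidableEq Zfin := inferInstanceAs (DecidableEq (Finset ℤ))

/-- The finite set of integers underlying an element of `ℤ_fin`. -/
abbrev Zfin.toFinset (J : Zfin) : Finset ℤ := ofBoolRing J

theorem mem_add_iff (I J : Zfin) (n : ℤ) : n ∈ (I + J).toFinset ↔
    n ∈ I.toFinset ∧ n ∉ J.toFinset ∨ n ∈ J.toFinset ∧ n ∉ I.toFinset :=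
  Finset.mem_symmDiff (s := I.toFinset) (t := J.toFinset)

theorem mem_mul_iff (I J : Zfin) (n : ℤ) :
    n ∈ (I * J).toFinset ↔ n ∈ I.toFinset ∧ n ∈ J.toFinset :=
  Finset.mem_inter (s₁ := I.toFinset) (s₂ := J.toFinset)

/-- The functor `ι_J = ∏_{j ∈ J} ι_j`. -/
def iotaFin (J : Zfin) : GrMod (gradA k) ⥤ GrMod (gradA k) := iotaList (J.toFinset.sort (· ≤ ·))

/-- The inclusion of `ι_J` into the identity functor. -/
def iotaIncFin (J : Zfin) : iotaFin k J ⟶ 𝟭 (GrMod (gradA k)) := iotaListIncl _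

/-- The polynomial `h_J = ∏_{j ∈ J} (z + j)²`. -/
def hpoly (J : Zfin) : k[X] := ∏ j ∈ J.toFinset, (X + C (j : k)) ^ 2

variable {k}

/-- The linear map `a ↦ v a` from `A` to a right module. -/
def elemLin (N : GrMod (gradA k)) (v : N.carrier) :
    A (X ^ 2 : k[X]) →ₗ[(A (X ^ 2 : k[X]))ᵐᵒᵖ] N.carrier where
  toFun a := MulOpposite.op a • v
  map_add' a b := by rw [MulOpposite.op_add, add_smul]
  map_smul' r a := by
    rw [RingHom.id_apply, ← mul_smul]
    rfl

/-- The morphism from `A` to a graded module sending `1` to a given element of degree `0`. -/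
def ofElem {N : GrMod (gradA k)} (v : N.carrier) (hv : v ∈ N.deg 0) : modA k ⟶ N :=
  GrMod.ofLin (M := modA k) (elemLin N v) fun i a ha => by
    have := N.smul_mem hv (show a ∈ gradA k i from ha)
    rwa [zero_add] at this

/-- Left multiplication by a polynomial in `z`, as an endomorphism of the graded module `A`. -/
def leftMul (p : k[X]) : modA k ⟶ modA k :=
  ofElem (N := modA k) (poly (X ^ 2) p) (poly_mem (X ^ 2) p)

theorem toLin_leftMul (p : k[X]) (a : A (X ^ 2 : k[X])) :
    GrMod.toLin (leftMul p) a = poly (X ^ 2) p * a := rfl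

/-- The image of `1` under a morphism out of `A`. -/
def atOne {N : GrMod (gradA k)} (c : modA k ⟶ N) : N.carrier :=
  GrMod.toLin c (1 : A (X ^ 2 : k[X]))

theorem atOne_mem {N : GrMod (gradA k)} (c : modA k ⟶ N) : atOne c ∈ N.deg 0 :=
  GrMod.toLin_mem c (SetLike.one_mem_graded (grading (X ^ 2 : k[X])))

@[simp] theorem atOne_ofElem {N : GrMod (gradA k)} (v : N.carrier) (hv : v ∈ N.deg 0) :
    atOne (ofElem v hv) = v :=
  one_smul _ v

theorem atOne_comp {N N' : GrMod (gradA k)} (c : modA k ⟶ N) (g : N ⟶ N') :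
    atOne (c ≫ g) = GrMod.toLin g (atOne c) := rfl

theorem toLin_eq_smul {N : GrMod (gradA k)} (c : modA k ⟶ N) (a : (modA k).carrier) :
    GrMod.toLin c a = MulOpposite.op (show A (X ^ 2 : k[X]) from a) • atOne c :=
  (congrArg (GrMod.toLin c) (one_mul (show A (X ^ 2 : k[X]) from a)).symm).trans
    (map_smul (GrMod.toLin c) (MulOpposite.op (show A (X ^ 2 : k[X]) from a)) _)

/-- A morphism out of `A` is determined by the image of `1`. -/
theorem hom_ext_one {N : GrMod (gradA k)} {c d : modA k ⟶ N} (h : atOne c = atOne d) : c = d :=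
  GrMod.hom_ext fun a =>
    (toLin_eq_smul c a).trans ((congrArg _ h).trans (toLin_eq_smul d a).symm)

/-! ### The degree-zero part of `ι_J A` -/

theorem iotaListIncl_injective (l : List ℤ) (P : GrMod (gradA k)) :
    Function.Injective (GrMod.toLin ((iotaListIncl l).app P)) := by
  induction l with
  | nil => exact fun _ _ h => h
  | cons j l ih => exact fun a b h => Subtype.ext (ih h)

/-- Multiplication by `(z + n)²` maps `P_0` into `ι_n P`. -/
theorem smul_mem_iotaSub (n : ℤ) {P : GrMod (gradA k)} {m : P.carrier} (hm : m ∈ P.deg 0) :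
    MulOpposite.op (poly (X ^ 2) ((X + C (n : k)) ^ 2)) • m ∈ iotaSub n P := by
  rw [mem_iotaSub]
  constructor
  · intro φ
    obtain ⟨a, ha, ha'⟩ := GrMod.toLin_mem φ hm
    change A (X ^ 2 : k[X]) at a
    rw [map_smul, ← ha']
    refine (Submodule.Quotient.mk_eq_zero _ (x := a * poly (X ^ 2) ((X + C (n : k)) ^ 2))).2 ?_
    change a * poly (X ^ 2) ((X + C (n : k)) ^ 2) ∈ rightIdeal k .x
    rw [mul_poly (X ^ 2) ha]
    refine Submodule.mem_span_singleton.2 ⟨MulOpposite.op (gen (X ^ 2) .y * a), ?_⟩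
    change gen (X ^ 2) .x * (gen (X ^ 2) .y * a) = _
    rw [← mul_assoc, gen_xy]
    congr 2
    simp [add_assoc]
  · intro ψ
    obtain ⟨a, ha, ha'⟩ := GrMod.toLin_mem ψ hm
    change A (X ^ 2 : k[X]) at a
    rw [map_smul, ← ha']
    refine (Submodule.Quotient.mk_eq_zero _ (x := a * poly (X ^ 2) ((X + C (n : k)) ^ 2))).2 ?_
    change a * poly (X ^ 2) ((X + C (n : k)) ^ 2) ∈ rightIdeal k .y
    rw [mul_poly (X ^ 2) ha]
    refine Submodule.mem_span_singleton.2 ⟨MulOpposite.op (gen (X ^ 2) .x * a), ?_⟩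
    change gen (X ^ 2) .y * (gen (X ^ 2) .x * a) = _
    rw [← mul_assoc, gen_yx]
    congr 1
    simp [poly, sub_eq_add_neg, add_assoc]

theorem dvd_of_mem_iotaSub (n : ℤ) {p : k[X]}
    (hp : (show (modA k).carrier from poly (X ^ 2) p) ∈ iotaSub n (modA k)) :
    (X + C (n : k)) ^ 2 ∣ p := by
  rw [mem_iotaSub] at hp
  cases n with
  | ofNat n =>
    have hy : gen (X ^ 2 : k[X]) .y ^ n ∈ gradA k (0 - Int.ofNat n) := by
      have := SetLike.pow_mem_graded n (gen_mem (X ^ 2 : k[X]) .y)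
      rwa [show n • Gen.y.degree = 0 - Int.ofNat n by simp [Gen.degree]] at this
    let φ : modA k ⟶ (quotX k).shift (Int.ofNat n) :=
      ofElem (N := (quotX k).shift (Int.ofNat n)) ((rightIdeal k .x).mkQ (gen (X ^ 2) .y ^ n))
        ⟨_, hy, rfl⟩
    have h : gen (X ^ 2) .y ^ n * poly (X ^ 2) p ∈ rightIdeal k .x :=
      (Submodule.Quotient.mk_eq_zero _).1 (hp.1 φ)
    obtain ⟨b, hb⟩ := Submodule.mem_span_singleton.1 h
    have := dvd_of_mem_x (X ^ 2 : k[X]) (b := b.unop) hb.symm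
    obtain ⟨q, hq⟩ := this
    refine ⟨q.comp (X + C (n : k)), ?_⟩
    have := congrArg (fun r => r.comp (X + C (n : k))) hq
    simpa [comp_assoc] using this
  | negSucc n =>
    have hx : gen (X ^ 2 : k[X]) .x ^ n ∈ gradA k (0 - (Int.negSucc n + 1)) := by
      have := SetLike.pow_mem_graded n (gen_mem (X ^ 2 : k[X]) .x)
      rwa [show n • Gen.x.degree = 0 - (Int.negSucc n + 1) by
        simp [Gen.degree]] at this
    let φ : modA k ⟶ (quotY k).shift (Int.negSucc n + 1) :=
      ofElem (N := (quotY k).shift (Int.negSucc n + 1)) ((rightIdeal k .y).mkQ (gen (X ^ 2) .x ^ n))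
        ⟨_, hx, rfl⟩
    have h : gen (X ^ 2) .x ^ n * poly (X ^ 2) p ∈ rightIdeal k .y :=
      (Submodule.Quotient.mk_eq_zero _).1 (hp.2 φ)
    obtain ⟨b, hb⟩ := Submodule.mem_span_singleton.1 h
    have := dvd_of_mem_y (X ^ 2 : k[X]) (b := b.unop) hb.symm
    obtain ⟨q, hq⟩ := this
    refine ⟨q.comp (X - C (n : k)), ?_⟩
    have := congrArg (fun r => r.comp (X - C (n : k))) hq
    have e : (X : k[X]) + C ((Int.negSucc n : ℤ) : k) = X - C (n : k) - C 1 := by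
      rw [Int.cast_negSucc]; simp; ring
    rw [e]
    simpa [comp_assoc] using this

theorem mem_iotaList {l : List ℤ} {n : ℤ} (hn : n ∈ l) (P : GrMod (gradA k))
    (m : ((iotaList l).obj P).carrier) :
    GrMod.toLin ((iotaListIncl l).app P) m ∈ iotaSub n P := by
  induction l with
  | nil => simp at hn
  | cons j l ih =>
    rcases List.mem_cons.1 hn with rfl | hn'
    · exact map_mem_iotaSub n ((iotaListIncl l).app P) m.2
    · exact ih hn' m.1

theorem exists_iotaList (l : List ℤ) (P : GrMod (gradA k)) {m : P.carrier} (hm : m ∈ P.deg 0) :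
    ∃ m' ∈ ((iotaList l).obj P).deg 0, GrMod.toLin ((iotaListIncl l).app P) m' =
      MulOpposite.op (poly (X ^ 2) ((l.map fun j : ℤ => (X + C (j : k)) ^ 2).prod)) • m := by
  induction l with
  | nil =>
    refine ⟨m, hm, ?_⟩
    change m = _
    simp
  | cons j l ih =>
    obtain ⟨m', h1, h2⟩ := ih
    refine ⟨⟨_, smul_mem_iotaSub j h1⟩, ?_, ?_⟩
    · have := ((iotaList l).obj P).smul_mem h1 (poly_mem (X ^ 2) ((X + C (j : k)) ^ 2))
      rwa [zero_add] at this
    · refine (map_smul (GrMod.toLin ((iotaListIncl l).app P)) _ m').trans ?_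
      rw [h2, ← mul_smul, ← MulOpposite.op_mul, ← map_mul, List.map_cons, List.prod_cons, mul_comm]

/-! ### The ring `B` -/

variable (k)

/-- The component `B_J = Hom_{gr A}(A, ι_J A)`. -/
abbrev BComp (J : Zfin) : Type u := modA k ⟶ (iotaFin k J).obj (modA k)

/-- The inclusion of `ι_J A` into `A`. -/
abbrev inclA (J : Zfin) : (iotaFin k J).obj (modA k) ⟶ modA k := (iotaIncFin k J).app (modA k)

/-- The inclusion of `ι_J ι_I A` into `A`. -/
abbrev inclA₂ (J I : Zfin) : (iotaFin k J).obj ((iotaFin k I).obj (modA k)) ⟶ modA k :=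
  (iotaIncFin k J).app ((iotaFin k I).obj (modA k)) ≫ inclA k I

variable {k}

/-- The relation `c = ι_{I⊕J}(σ_{I∩J}) ∘ ι_J(a) ∘ b` between `a ∈ B_I`, `b ∈ B_J` and
`c ∈ B_{I⊕J}`. Here `σ_K : ι_K² A → A` is the isomorphism given by left multiplication by `h_K⁻¹`,
and `ι_{I⊕J}(σ_{I∩J}) : ι_J ι_I A = ι_{I⊕J} ι_{I∩J}² A → ι_{I⊕J} A` is its restriction, since
`ι_{I⊕J}` acts on morphisms by restriction. So the relation says that `c`, followed by left multiplication by
`h_{I∩J}`, is `ι_J(a) ∘ b`, as morphisms from `A` to `A`. -/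
def IsProd {I J : Zfin} (a : BComp k I) (b : BComp k J) (c : BComp k (I + J)) : Prop :=
  c ≫ inclA k (I + J) ≫ leftMul (hpoly k (I * J)) = b ≫ (iotaFin k J).map a ≫ inclA₂ k J I

/-- The element of `A` by which a morphism `A → ι_J A ⊆ A` acts by left multiplication. -/
def val {J : Zfin} (a : BComp k J) : A (X ^ 2 : k[X]) := atOne (a ≫ inclA k J)

theorem val_injective {J : Zfin} : Function.Injective (val : BComp k J → A (X ^ 2 : k[X])) :=
  fun _ _ h => hom_ext_one (iotaListIncl_injective _ _ h)

theorem val_add {J : Zfin} (a b : BComp k J) : val (a + b) = val a + val b :=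
  map_add (GrMod.toLin (inclA k J)) (atOne a) (atOne b)

theorem val_zero {J : Zfin} : val (0 : BComp k J) = 0 :=
  map_zero (GrMod.toLin (inclA k J))

theorem val_smul {J : Zfin} (r : k) (a : BComp k J) : val (r • a) = r • val a :=
  GrMod.toLin_smul_base (inclA k J) r (atOne a)

theorem isProd_iff {I J : Zfin} (a : BComp k I) (b : BComp k J) (c : BComp k (I + J)) :
    IsProd a b c ↔ poly (X ^ 2) (hpoly k (I * J)) * val c = val a * val b := by
  have h2 : b ≫ (iotaFin k J).map a ≫ inclA₂ k J I = (b ≫ inclA k J) ≫ a ≫ inclA k I := by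
    have := (iotaIncFin k J).naturality a
    simp only [inclA₂, Category.assoc]
    rw [← Category.assoc ((iotaFin k J).map a), this]
    simp
  have e1 : atOne (c ≫ inclA k (I + J) ≫ leftMul (hpoly k (I * J))) =
      poly (X ^ 2) (hpoly k (I * J)) * val c := rfl
  have e2 : atOne ((b ≫ inclA k J) ≫ a ≫ inclA k I) = val a * val b :=
    toLin_eq_smul (a ≫ inclA k I) (val b)
  rw [IsProd, h2]
  exact ⟨fun h => e1.symm.trans ((congrArg atOne h).trans e2),
    fun h => hom_ext_one (e1.trans (h.trans e2.symm))⟩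

theorem hpoly_ne_zero (J : Zfin) : hpoly k J ≠ 0 :=
  Finset.prod_ne_zero_iff.2 fun _ _ => pow_ne_zero _ (X_add_C_ne_zero _)

theorem hpoly_mul_cancel (J : Zfin) {p q : k[X]} (h : hpoly k J * p = hpoly k J * q) : p = q :=
  mul_left_cancel₀ (hpoly_ne_zero J) h

theorem hpoly_mul_hpoly (I J : Zfin) :
    hpoly k I * hpoly k J = hpoly k (I * J) * (hpoly k (I * J) * hpoly k (I + J)) := by
  have h1 : Disjoint (I * J).toFinset (I + J).toFinset := by
    rw [Finset.disjoint_left]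
    intro n h h'
    rw [mem_mul_iff] at h
    rw [mem_add_iff] at h'
    tauto
  have h2 : (I * J).toFinset ∪ (I + J).toFinset = I.toFinset ∪ J.toFinset := by
    ext n
    rw [Finset.mem_union, Finset.mem_union, mem_mul_iff, mem_add_iff]
    tauto
  have h3 : (I * J).toFinset = I.toFinset ∩ J.toFinset := rfl
  rw [hpoly, hpoly, hpoly, hpoly, ← Finset.prod_union h1, h2, h3, mul_comm (∏ j ∈ _ ∩ _, _),
    Finset.prod_union_inter]

/-- Morphisms `A → ι_J A` from the multiples of `h_J`. -/
theorem exists_val {J : Zfin} {p : k[X]} (h : hpoly k J ∣ p) :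
    ∃ c : BComp k J, val c = poly (X ^ 2) p := by
  obtain ⟨q, rfl⟩ := h
  obtain ⟨m, h1, h2⟩ := exists_iotaList (J.toFinset.sort (· ≤ ·)) (modA k)
    (m := (poly (X ^ 2) q : A (X ^ 2 : k[X]))) (poly_mem (X ^ 2) q)
  refine ⟨ofElem m h1, ?_⟩
  have e : ((J.toFinset.sort (· ≤ ·)).map fun j : ℤ => (X + C (j : k)) ^ 2).prod = hpoly k J := by
    rw [hpoly, Finset.prod_eq_multiset_prod, ← Finset.sort_eq J.toFinset (· ≤ ·),
      Multiset.map_coe, Multiset.prod_coe]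
  rw [e] at h2
  have e' : val (ofElem m h1 : BComp k J) =
      GrMod.toLin ((iotaListIncl (J.toFinset.sort (· ≤ ·))).app (modA k)) m :=
    congrArg (GrMod.toLin ((iotaListIncl (J.toFinset.sort (· ≤ ·))).app (modA k)))
      (atOne_ofElem m h1)
  rw [e', h2, mul_comm (hpoly k J), map_mul]
  rfl

theorem hpoly_zero : hpoly k 0 = 1 := Finset.prod_empty

theorem hpoly_assoc (I J K : Zfin) :
    hpoly k (I * J) * hpoly k ((I + J) * K) = hpoly k (J * K) * hpoly k (I * (J + K)) := by
  have h1 : Disjoint (I * J).toFinset ((I + J) * K).toFinset := by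
    rw [Finset.disjoint_left]
    intro n h h'
    rw [mem_mul_iff] at h h'
    rw [mem_add_iff] at h'
    tauto
  have h2 : Disjoint (J * K).toFinset (I * (J + K)).toFinset := by
    rw [Finset.disjoint_left]
    intro n h h'
    rw [mem_mul_iff] at h h'
    rw [mem_add_iff] at h'
    tauto
  have h3 : (I * J).toFinset ∪ ((I + J) * K).toFinset =
      (J * K).toFinset ∪ (I * (J + K)).toFinset := by
    ext n
    simp only [Finset.mem_union, mem_mul_iff, mem_add_iff]
    tauto
  rw [hpoly, hpoly, hpoly, hpoly, ← Finset.prod_union h1, ← Finset.prod_union h2, h3]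

variable (k) in
/-- The identity element of `B`: the identity morphism `A → A = ι_∅ A`. -/
def oneB : BComp k 0 := (exists_val (k := k) (J := 0) (p := 1) (by rw [hpoly_zero])).choose

theorem val_oneB : val (oneB k) = 1 :=
  (exists_val (k := k) (J := 0) (p := 1) (by rw [hpoly_zero])).choose_spec.trans (map_one _)

variable [CharZero k]

/-- Morphisms `A → ι_J A` act by left multiplication by multiples of `h_J`. -/
theorem exists_poly_val {J : Zfin} (a : BComp k J) :
    ∃ p : k[X], hpoly k J ∣ p ∧ val a = poly (X ^ 2) p := by
  obtain ⟨p, hp⟩ := exists_poly (X ^ 2 : k[X]) (atOne_mem (a ≫ inclA k J))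
  refine ⟨p, ?_, hp.symm⟩
  refine Finset.prod_dvd_of_coprime ?_ ?_
  · intro i _ j _ hij
    refine IsCoprime.pow (x := X + C (i : k)) (y := X + C (j : k)) ?_
    have : (X + C (i : k)) = X - C (-(i : k)) := by simp
    rw [this, show (X + C (j : k)) = X - C (-(j : k)) by simp]
    exact isCoprime_X_sub_C_of_isUnit_sub (by
      rw [isUnit_iff_ne_zero]
      intro h
      exact hij (Int.cast_injective (α := k) (by linear_combination -h)))
  · intro n hn
    have := mem_iotaList (l := J.toFinset.sort (· ≤ ·)) ((Finset.mem_sort _).2 hn) (modA k)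
      (atOne a)
    refine dvd_of_mem_iotaSub n ?_
    rw [show (show (modA k).carrier from poly (X ^ 2) p) = _ from hp]
    exact this

theorem existsUnique_isProd {I J : Zfin} (a : BComp k I) (b : BComp k J) :
    ∃! c : BComp k (I + J), IsProd a b c := by
  obtain ⟨p, ⟨p', rfl⟩, hp⟩ := exists_poly_val a
  obtain ⟨q, ⟨q', rfl⟩, hq⟩ := exists_poly_val b
  obtain ⟨c, hc⟩ := exists_val (k := k) (J := I + J)
    (p := hpoly k (I + J) * (hpoly k (I * J) * (p' * q'))) (dvd_mul_right _ _)
  refine ⟨c, ?_, ?_⟩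
  · change IsProd a b c
    rw [isProd_iff, hc, hp, hq, ← map_mul, ← map_mul]
    congr 1
    linear_combination (-(p' * q')) * hpoly_mul_hpoly (k := k) I J
  · intro d hd
    change IsProd a b d at hd
    rw [isProd_iff, hp, hq, ← map_mul] at hd
    obtain ⟨r, -, hr⟩ := exists_poly_val d
    rw [hr, ← map_mul] at hd
    refine val_injective ?_
    rw [hc, hr]
    congr 1
    refine hpoly_mul_cancel (I * J) ((poly_injective _ hd).trans ?_)
    linear_combination (p' * q') * hpoly_mul_hpoly (k := k) I J

/-- The multiplication `B_I × B_J → B_{I⊕J}`, `a · b = ι_{I⊕J}(σ_{I∩J}) ∘ ι_J(a) ∘ b`. -/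
def mulB {I J : Zfin} (a : BComp k I) (b : BComp k J) : BComp k (I + J) :=
  (existsUnique_isProd a b).choose

theorem isProd_mulB {I J : Zfin} (a : BComp k I) (b : BComp k J) : IsProd a b (mulB a b) :=
  (existsUnique_isProd a b).choose_spec.1

/-- The polynomial by which an element of `B_J` acts. -/
def pval {J : Zfin} (a : BComp k J) : k[X] := (exists_poly_val a).choose

theorem poly_pval {J : Zfin} (a : BComp k J) : poly (X ^ 2) (pval a) = val a :=
  (exists_poly_val a).choose_spec.2.symm

theorem pval_mulB {I J : Zfin} (a : BComp k I) (b : BComp k J) :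
    hpoly k (I * J) * pval (mulB a b) = pval a * pval b := by
  apply poly_injective (X ^ 2 : k[X])
  rw [map_mul, map_mul, poly_pval, poly_pval, poly_pval]
  exact (isProd_iff _ _ _).1 (isProd_mulB a b)

theorem pval_eq_iff {J : Zfin} (a : BComp k J) (p : k[X]) :
    pval a = p ↔ val a = poly (X ^ 2) p := by
  rw [← poly_pval]
  exact (poly_injective (X ^ 2 : k[X])).eq_iff.symm

theorem pval_add {J : Zfin} (a b : BComp k J) : pval (a + b) = pval a + pval b := by
  rw [pval_eq_iff, map_add, val_add, poly_pval, poly_pval]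

theorem pval_zero {J : Zfin} : pval (0 : BComp k J) = 0 := by
  rw [pval_eq_iff, map_zero, val_zero]

theorem pval_smul {J : Zfin} (r : k) (a : BComp k J) : pval (r • a) = r • pval a := by
  rw [pval_eq_iff, map_smul, val_smul, poly_pval]

theorem mk_eq_mk {I J : Zfin} (h : I = J) {a : BComp k I} {b : BComp k J} (h' : pval a = pval b) :
    GradedMonoid.mk (A := BComp k) I a = GradedMonoid.mk J b := by
  subst h
  congr 1
  apply val_injective
  rw [← poly_pval, h', poly_pval]

theorem eq_of_pval {J : Zfin} {a b : BComp k J} (h : pval a = pval b) : a = b :=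
  val_injective (by rw [← poly_pval, h, poly_pval])

theorem pval_oneB : pval (oneB k) = 1 := by rw [pval_eq_iff, val_oneB, map_one]

theorem pval_oneB_mul {J : Zfin} (b : BComp k J) : pval (mulB (oneB k) b) = pval b := by
  have := pval_mulB (oneB k) b
  rwa [zero_mul, hpoly_zero, one_mul, pval_oneB, one_mul] at this

theorem pval_mulB_comm {I J : Zfin} (a : BComp k I) (b : BComp k J) :
    pval (mulB a b) = pval (mulB b a) := by
  apply hpoly_mul_cancel (I * J)
  rw [pval_mulB, mul_comm I J, pval_mulB, mul_comm]

instance : GradedMonoid.GOne (BComp k) := ⟨oneB k⟩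

instance : GradedMonoid.GMul (BComp k) := ⟨mulB⟩

instance : GradedMonoid.GMonoid (BComp k) where
  one_mul a := mk_eq_mk (zero_add _) (pval_oneB_mul a.2)
  mul_one a := mk_eq_mk (add_zero _) ((pval_mulB_comm _ _).trans (pval_oneB_mul a.2))
  mul_assoc a b c := mk_eq_mk (add_assoc _ _ _) (by
    change pval (mulB (mulB a.2 b.2) c.2) = pval (mulB a.2 (mulB b.2 c.2))
    apply mul_left_cancel₀ (mul_ne_zero (hpoly_ne_zero (k := k) (a.1 * b.1))
      (hpoly_ne_zero ((a.1 + b.1) * c.1)))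
    have h1 := pval_mulB (mulB a.2 b.2) c.2
    have h2 := pval_mulB a.2 b.2
    have h3 := pval_mulB a.2 (mulB b.2 c.2)
    have h4 := pval_mulB b.2 c.2
    have h5 := hpoly_assoc (k := k) a.1 b.1 c.1
    linear_combination hpoly k (a.1 * b.1) * h1 + pval c.2 * h2 - hpoly k (b.1 * c.1) * h3 -
      pval a.2 * h4 - pval (mulB a.2 (mulB b.2 c.2)) * h5)

instance : DirectSum.GRing (BComp k) where
  mul_zero a := eq_of_pval (hpoly_mul_cancel _ (by
    rw [pval_zero, mul_zero]
    exact (pval_mulB a 0).trans (by rw [pval_zero, mul_zero])))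
  zero_mul a := eq_of_pval (hpoly_mul_cancel _ (by
    rw [pval_zero, mul_zero]
    exact (pval_mulB 0 a).trans (by rw [pval_zero, zero_mul])))
  mul_add a b c := eq_of_pval (hpoly_mul_cancel _ (by
    refine (pval_mulB a (b + c)).trans ?_
    rw [pval_add, pval_add, mul_add, mul_add]
    exact congrArg₂ _ (pval_mulB a b).symm (pval_mulB a c).symm))
  add_mul a b c := eq_of_pval (hpoly_mul_cancel _ (by
    refine (pval_mulB (a + b) c).trans ?_
    rw [pval_add, pval_add, add_mul, mul_add]
    exact congrArg₂ _ (pval_mulB a c).symm (pval_mulB b c).symm))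
  natCast n := (n : k) • oneB k
  natCast_zero := by simp
  natCast_succ n := by rw [Nat.cast_succ, add_smul, one_smul]; rfl
  intCast n := (n : k) • oneB k
  intCast_ofNat n := by simp
  intCast_negSucc_ofNat n := by rw [Int.cast_negSucc, neg_smul]

theorem pval_smul_oneB_mul (r : k) {J : Zfin} (b : BComp k J) :
    pval (mulB (r • oneB k) b) = r • pval b := by
  have := pval_mulB (r • oneB k) b
  rwa [zero_mul, hpoly_zero, one_mul, pval_smul, pval_oneB, smul_mul_assoc, one_mul] at this

instance : DirectSum.GAlgebra k (BComp k) where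
  toFun := { toFun := fun r => r • oneB k
             map_zero' := zero_smul _ _
             map_add' := fun r s => add_smul r s _ }
  map_one := one_smul _ _
  map_mul r s := mk_eq_mk (zero_add _).symm (by
    refine Eq.trans ?_ (pval_smul_oneB_mul r (s • oneB k)).symm
    change pval ((r * s) • oneB k) = _
    rw [pval_smul, pval_smul, smul_smul])
  commutes r a := mk_eq_mk ((zero_add _).trans (add_zero _).symm) (pval_mulB_comm _ _)
  smul_def r a := mk_eq_mk (zero_add _).symm (by
    refine Eq.trans ?_ (pval_smul_oneB_mul r a.2).symm
    exact pval_smul r a.2)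

variable (k)

/-- The ring `B = ⨁_J Hom_{gr A}(A, ι_J A)`, a `k`-algebra. -/
abbrev B : Type u := ⨁ J, BComp k J

/-- The component of degree `J` of `B`. -/
def gradB (J : Zfin) : Submodule k (B k) := LinearMap.range (DirectSum.lof k Zfin (BComp k) J)

instance : SetLike.GradedMonoid (gradB k) where
  one_mem := ⟨oneB k, rfl⟩
  mul_mem := by
    rintro I J _ _ ⟨a, rfl⟩ ⟨b, rfl⟩
    exact ⟨mulB a b, (DirectSum.of_mul_of a b).symm⟩

instance : GradedAlgebra (gradB k) where
  toDecomposition := DirectSum.IsInternal.chooseDecomposition _ (by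
    refine isInternal_of_proj (gradB k)
      (fun J => DirectSum.lof k Zfin (BComp k) J ∘ₗ DirectSum.component k Zfin (BComp k) J)
      ?_ ?_ ?_
    · rintro J _ ⟨a, rfl⟩
      simp
    · rintro I J h _ ⟨a, rfl⟩
      simp [DirectSum.component.of, h.symm]
    · rw [eq_top_iff]
      intro b _
      induction b using DirectSum.induction_on with
      | zero => exact Submodule.zero_mem _
      | of J a => exact Submodule.mem_iSup_of_mem J ⟨a, rfl⟩
      | add a b iha ihb => exact Submodule.add_mem _ (iha trivial) (ihb trivial))

end Involutions

end GWA

end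

noncomputable section

namespace GWA

section

open Polynomial

/-! ### Finite sets of integers -/

theorem Zfin.ext_mem {I J : Zfin} (h : ∀ n, n ∈ I.toFinset ↔ n ∈ J.toFinset) : I = J :=
  Finset.ext (α := ℤ) h

theorem Zfin.not_mem_zero (n : ℤ) : n ∉ (0 : Zfin).toFinset := Finset.notMem_empty n

theorem Zfin.eq_zero {J : Zfin} (h : ∀ n, n ∉ J.toFinset) : J = 0 :=
  Finset.eq_empty_of_forall_notMem (α := ℤ) h

/-- A one-element subset of `ℤ`. -/
def pt (i : ℤ) : Zfin := toBoolRing {i}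

@[simp] theorem mem_pt {i n : ℤ} : n ∈ (pt i).toFinset ↔ n = i := Finset.mem_singleton

/-- The set of integers separating `0` and `i`: the interval `[0, i)` or `[i, 0)`. -/
def seg (i : ℤ) : Zfin := toBoolRing (Finset.Ico 0 i ∪ Finset.Ico i 0)

@[simp] theorem mem_seg {i n : ℤ} : n ∈ (seg i).toFinset ↔ 0 ≤ n ∧ n < i ∨ i ≤ n ∧ n < 0 := by
  change n ∈ Finset.Ico 0 i ∪ Finset.Ico i 0 ↔ _
  simp

attribute [irreducible] pt seg

theorem Zfin.add_self (J : Zfin) : J + J = 0 :=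
  Zfin.eq_zero fun n => by simp [mem_add_iff]

theorem Zfin.add_cancel_left (I J : Zfin) : I + (I + J) = J := by
  rw [← add_assoc, Zfin.add_self, zero_add]

theorem Zfin.mul_self (J : Zfin) : J * J = J :=
  Zfin.ext_mem fun n => by simp [mem_mul_iff]

theorem seg_add_pt (i : ℤ) : seg i + pt i = seg (i + 1) :=
  Zfin.ext_mem fun n => by simp only [mem_add_iff, mem_seg, mem_pt]; omega

theorem seg_add_pt_sub (i : ℤ) : seg i + pt (i - 1) = seg (i - 1) :=
  Zfin.ext_mem fun n => by simp only [mem_add_iff, mem_seg, mem_pt]; omega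

theorem seg_add_seg_mul_pt {i j : ℤ} (h : i ≤ j) : (seg i + seg j) * pt j = 0 :=
  Zfin.eq_zero fun n => by
    simp only [mem_mul_iff, mem_add_iff, mem_seg, mem_pt]; omega

theorem seg_add_seg_mul_pt_of_lt {i j : ℤ} (h : j < i) : (seg i + seg j) * pt j = pt j :=
  Zfin.ext_mem fun n => by
    simp only [mem_mul_iff, mem_add_iff, mem_seg, mem_pt]; omega

theorem exists_disjoint_seg (J : Zfin) : ∃ a b : ℤ, (J + seg a) * (J + seg b) = 0 := by
  obtain ⟨a, ha⟩ := J.toFinset.bddBelow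
  obtain ⟨b, hb⟩ := J.toFinset.bddAbove
  refine ⟨min a 0, max (b + 1) 0, Zfin.eq_zero fun n => ?_⟩
  by_cases hn : n ∈ J.toFinset
  · have h1 := ha hn
    have h2 := hb hn
    simp only [mem_mul_iff, mem_add_iff, mem_seg, hn, true_and, not_true, and_false, or_false]
    omega
  · simp only [mem_mul_iff, mem_add_iff, mem_seg, hn, false_and, not_false_eq_true,
      and_true, false_or]
    omega

variable {k : Type u} [Field k]

theorem hpoly_pt (i : ℤ) : hpoly k (pt i) = (X + C (i : k)) ^ 2 := by
  unfold pt
  exact Finset.prod_singleton _ _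

variable [CharZero k]

theorem isCoprime_hpoly {I J : Zfin} (h : I * J = 0) : IsCoprime (hpoly k I) (hpoly k J) := by
  refine IsCoprime.prod_left fun i hi => IsCoprime.prod_right fun j hj => IsCoprime.pow ?_
  have hij : i ≠ j := by
    rintro rfl
    have := (mem_mul_iff I J i).2 ⟨hi, hj⟩
    rw [h] at this
    exact Zfin.not_mem_zero i this
  have : (X + C (i : k)) = X - C (-(i : k)) := by simp
  rw [this, show (X + C (j : k)) = X - C (-(j : k)) by simp]
  exact isCoprime_X_sub_C_of_isUnit_sub (by
    rw [isUnit_iff_ne_zero]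
    intro h
    exact hij (Int.cast_injective (α := k) (by linear_combination -h)))

variable (k) in
theorem exists_isCoprime_seg (J : Zfin) : ∃ a b : ℤ, ∃ p q : k[X],
    p * hpoly k (J + seg a) + q * hpoly k (J + seg b) = 1 := by
  obtain ⟨a, b, h⟩ := exists_disjoint_seg J
  obtain ⟨p, q, h⟩ := isCoprime_hpoly (k := k) h
  exact ⟨a, b, p, q, h⟩

/-! ### Elements of the ring `B` -/

theorem hpoly_dvd_pval {J : Zfin} (a : BComp k J) : hpoly k J ∣ pval a := by
  obtain ⟨p, h, h'⟩ := exists_poly_val a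
  rwa [(pval_eq_iff a p).2 h']

theorem exists_coef {J : Zfin} (a : BComp k J) : ∃ p, pval a = hpoly k J * p := hpoly_dvd_pval a

/-- Elements of `B_J` act by multiplication by a multiple of `h_J`; this is the cofactor. -/
def coef (J : Zfin) : BComp k J →ₗ[k] k[X] where
  toFun a := (exists_coef a).choose
  map_add' a b := by
    apply hpoly_mul_cancel J
    rw [← (exists_coef (a + b)).choose_spec, mul_add, ← (exists_coef a).choose_spec,
      ← (exists_coef b).choose_spec, pval_add]
  map_smul' r a := by
    apply hpoly_mul_cancel J
    rw [← (exists_coef (r • a)).choose_spec, RingHom.id_apply, mul_smul_comm,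
      ← (exists_coef a).choose_spec, pval_smul]

theorem pval_eq_coef {J : Zfin} (a : BComp k J) : pval a = hpoly k J * coef J a :=
  (exists_coef a).choose_spec

theorem coef_injective (J : Zfin) : Function.Injective (coef (k := k) J) := fun a b h =>
  eq_of_pval (by rw [pval_eq_coef, h, ← pval_eq_coef])

theorem coef_surjective (J : Zfin) : Function.Surjective (coef (k := k) J) := fun p => by
  obtain ⟨c, hc⟩ := exists_val (k := k) (dvd_mul_right (hpoly k J) p)
  refine ⟨c, hpoly_mul_cancel J ?_⟩
  rw [← pval_eq_coef, pval_eq_iff, hc]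

theorem coef_mulB {I J : Zfin} (a : BComp k I) (b : BComp k J) :
    coef (I + J) (mulB a b) = hpoly k (I * J) * (coef I a * coef J b) := by
  apply hpoly_mul_cancel (I + J)
  apply hpoly_mul_cancel (I * J)
  rw [← pval_eq_coef, pval_mulB, pval_eq_coef a, pval_eq_coef b]
  linear_combination (coef I a * coef J b) * hpoly_mul_hpoly (k := k) I J

theorem coef_oneB : coef 0 (oneB k) = 1 := by
  have := pval_eq_coef (oneB k)
  rwa [pval_oneB, hpoly_zero, one_mul, eq_comm] at this

/-- The components of `B` are free of rank one over `k[z]`. -/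
def coefEquiv (J : Zfin) : BComp k J ≃ₗ[k] k[X] :=
  LinearEquiv.ofBijective (coef J) ⟨coef_injective J, coef_surjective J⟩

/-- The element of `B_J` acting by multiplication by `h_J p`. -/
def el (J : Zfin) : k[X] →ₗ[k] B k :=
  DirectSum.lof k Zfin (BComp k) J ∘ₗ (coefEquiv J).symm.toLinearMap

theorem el_coef (J : Zfin) (a : BComp k J) : el J (coef J a) = DirectSum.of (BComp k) J a :=
  congrArg (DirectSum.lof k Zfin (BComp k) J) ((coefEquiv J).symm_apply_apply a)

theorem el_mul_el (I J : Zfin) (p q : k[X]) :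
    el I p * el J q = el (I + J) (hpoly k (I * J) * (p * q)) := by
  obtain ⟨a, rfl⟩ := coef_surjective I p
  obtain ⟨b, rfl⟩ := coef_surjective J q
  rw [el_coef, el_coef, ← coef_mulB, el_coef]
  exact DirectSum.of_mul_of a b

theorem el_zero_one : el 0 (1 : k[X]) = 1 := by
  rw [← coef_oneB, el_coef]
  rfl

theorem el_mem (J : Zfin) (p : k[X]) : el J p ∈ gradB k J := ⟨_, rfl⟩

theorem exists_el {J : Zfin} {b : B k} (hb : b ∈ gradB k J) : ∃ p, el J p = b := by
  obtain ⟨a, rfl⟩ := hb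
  exact ⟨coef J a, el_coef J a⟩

@[elab_as_elim]
theorem el_induction {motive : B k → Prop} (b : B k) (el : ∀ J p, motive (el J p))
    (add : ∀ a b, motive a → motive b → motive (a + b)) : motive b := by
  induction b using DirectSum.induction_on with
  | zero => simpa using el 0 0
  | of J a => rw [← el_coef]; exact el _ _
  | add a b ha hb => exact add a b ha hb

end

section

/-! ### Graded modules given by families of subspaces -/

namespace GrMod

variable {k : Type u} [Field k] {Γ : Type} [AddCommGroup Γ] [DecidableEq Γ]
  {R : Type u} [Ring R] [Algebra k R] {𝒜 : Γ → Submodule k R}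

@[elab_as_elim]
theorem homogeneous_induction {M : GrMod 𝒜} {motive : M.carrier → Prop} (m : M.carrier)
    (mem : ∀ γ, ∀ m ∈ M.deg γ, motive m) (add : ∀ m n, motive m → motive n → motive (m + n)) :
    motive m := by
  have hm : m ∈ ⨆ γ, M.deg γ := by rw [M.iSup_deg]; trivial
  induction hm using Submodule.iSup_induction' with
  | mem γ m hm => exact mem γ m hm
  | zero => exact mem 0 0 (Submodule.zero_mem _)
  | add m n _ _ hm hn => exact add m n hm hn

theorem toLin_injective {M N : GrMod 𝒜} (f : M ⟶ N)
    (h : ∀ γ, ∀ m ∈ M.deg γ, toLin f m = 0 → m = 0) : Function.Injective (toLin f) := by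
  rw [injective_iff_map_eq_zero]
  intro m hm
  obtain ⟨s, hs⟩ := M.exists_sum_proj m
  rw [← hs]
  refine Finset.sum_eq_zero fun γ _ => h γ _ (M.proj_mem γ m) ?_
  rw [← proj_map, hm, map_zero]

theorem toLin_surjective {M N : GrMod 𝒜} (f : M ⟶ N)
    (h : ∀ γ, ∀ n ∈ N.deg γ, ∃ m, toLin f m = n) : Function.Surjective (toLin f) := by
  intro n
  induction n using homogeneous_induction with
  | mem γ n hn => exact h γ n hn
  | add n n' ih ih' =>
    obtain ⟨m, rfl⟩ := ih
    obtain ⟨m', rfl⟩ := ih'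
    exact ⟨m + m', map_add _ _ _⟩

theorem isIso_of_bijective {M N : GrMod 𝒜} (f : M ⟶ N) (h : Function.Bijective (toLin f)) :
    IsIso f := by
  let e := LinearEquiv.ofBijective (toLin f) h
  have he : ∀ m, e m = toLin f m := fun _ => rfl
  refine ⟨ofLin e.symm.toLinearMap fun γ n hn => ?_, ?_, ?_⟩
  · have : e.symm n = M.proj γ (e.symm n) := by
      apply e.injective
      rw [e.apply_symm_apply, he, ← proj_map, ← he, e.apply_symm_apply, N.proj_same hn]
    exact this ▸ M.proj_mem γ _
  · ext m
    exact e.symm_apply_apply m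
  · ext n
    exact e.apply_symm_apply n

/-- Linear maps on the homogeneous components assemble to a linear map. -/
theorem exists_linearMap (M : GrMod 𝒜) {V : Type u} [AddCommGroup V] [Module k V]
    (g : Γ → M.carrier →ₗ[k] V) :
    ∃ Φ : M.carrier →ₗ[k] V, ∀ γ, ∀ m ∈ M.deg γ, Φ m = g γ m := by
  let e := LinearEquiv.ofBijective (DirectSum.coeLinearMap M.deg) M.isInternal
  refine ⟨DirectSum.toModule k Γ V (fun γ => g γ ∘ₗ (M.deg γ).subtype) ∘ₗ e.symm.toLinearMap,
    fun γ m hm => ?_⟩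
  have : e.symm m = DirectSum.lof k Γ (fun γ => M.deg γ) γ ⟨m, hm⟩ := by
    rw [LinearEquiv.symm_apply_eq]
    exact (DirectSum.coeLinearMap_lof M.deg γ ⟨m, hm⟩).symm
  simp [this]

/-- Right multiplication by a ring element, as a linear map. -/
def rmul (M : GrMod 𝒜) (r : R) : M.carrier →ₗ[k] M.carrier :=
  Algebra.lsmul k k M.carrier (MulOpposite.op r)

theorem rmul_apply (M : GrMod 𝒜) (r : R) (m : M.carrier) :
    M.rmul r m = MulOpposite.op r • m := rfl

theorem rmul_mem (M : GrMod 𝒜) {γ δ : Γ} {m : M.carrier} {r : R} (hm : m ∈ M.deg γ)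
    (hr : r ∈ 𝒜 δ) : M.rmul r m ∈ M.deg (γ + δ) := M.smul_mem hm hr

theorem rmul_rmul (M : GrMod 𝒜) (r s : R) (m : M.carrier) :
    M.rmul s (M.rmul r m) = M.rmul (r * s) m := by
  rw [rmul_apply, rmul_apply, rmul_apply, MulOpposite.op_mul, mul_smul]

theorem rmul_one (M : GrMod 𝒜) (m : M.carrier) : M.rmul 1 m = m := one_smul _ m

theorem rmul_add (M : GrMod 𝒜) (r s : R) (m : M.carrier) :
    M.rmul (r + s) m = M.rmul r m + M.rmul s m := add_smul _ _ m

theorem rmul_smul (M : GrMod 𝒜) (c : k) (r : R) (m : M.carrier) :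
    M.rmul (c • r) m = c • M.rmul r m := smul_assoc c (MulOpposite.op r) m

theorem toLin_rmul {M N : GrMod 𝒜} (f : M ⟶ N) (r : R) (m : M.carrier) :
    toLin f (M.rmul r m) = N.rmul r (toLin f m) := map_smul (toLin f) _ m

/-- The underlying map of a morphism, as a linear map over the base field. -/
def toLinBase {M N : GrMod 𝒜} (f : M ⟶ N) : M.carrier →ₗ[k] N.carrier where
  toFun := toLin f
  map_add' := map_add _
  map_smul' := toLin_smul_base f

@[simp] theorem toLinBase_apply {M N : GrMod 𝒜} (f : M ⟶ N) (m : M.carrier) :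
    toLinBase f m = toLin f m := rfl

/-- A degree-preserving map commuting with right multiplications, as a morphism. -/
def ofBase {M N : GrMod 𝒜} (Φ : M.carrier →ₗ[k] N.carrier)
    (h : ∀ r m, Φ (M.rmul r m) = N.rmul r (Φ m)) (hd : ∀ γ, ∀ m ∈ M.deg γ, Φ m ∈ N.deg γ) : M ⟶ N :=
  ofLin { toFun := Φ, map_add' := map_add Φ, map_smul' := fun r m => h r.unop m } hd

@[simp] theorem toLin_ofBase {M N : GrMod 𝒜} (Φ : M.carrier →ₗ[k] N.carrier) (h hd)
    (m : M.carrier) : toLin (ofBase (N := N) Φ h hd) m = Φ m := rfl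

section OfFamily

variable {V : Type u} [AddCommGroup V] [Module k V] (D : Γ → Submodule k V)

/-- The finitely supported functions with values in a family of subspaces. -/
def famCarrier : Submodule k (Γ →₀ V) where
  carrier := {f | ∀ γ, f γ ∈ D γ}
  add_mem' hf hg γ := (D γ).add_mem (hf γ) (hg γ)
  zero_mem' γ := (D γ).zero_mem
  smul_mem' c _ hf γ := (D γ).smul_mem c (hf γ)

variable {D} in
omit [AddCommGroup Γ] in
theorem single_mem_famCarrier {γ : Γ} {v : V} (hv : v ∈ D γ) :
    Finsupp.single γ v ∈ famCarrier D := by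
  intro δ
  rw [Finsupp.single_apply]
  split_ifs with h
  · exact h ▸ hv
  · exact (D δ).zero_mem

/-- A right action of `R` on the finitely supported functions that maps the component `D γ` in
degree `γ` to the component `D (γ + δ)` in degree `γ + δ` if `r` has degree `δ`. -/
def Compatible (𝒜 : Γ → Submodule k R) (φ : R →ₐ[k] (Module.End k (Γ →₀ V))ᵐᵒᵖ) : Prop :=
  ∀ γ δ, ∀ r ∈ 𝒜 δ, ∀ v ∈ D γ, ∃ v' ∈ D (γ + δ),
    (φ r).unop (Finsupp.single γ v) = Finsupp.single (γ + δ) v'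

variable {D} [GradedAlgebra 𝒜] {φ : R →ₐ[k] (Module.End k (Γ →₀ V))ᵐᵒᵖ}

theorem Compatible.map_mem (h : Compatible D 𝒜 φ) (r : R) {f : Γ →₀ V} (hf : f ∈ famCarrier D) :
    (φ r).unop f ∈ famCarrier D := by
  induction r using DirectSum.Decomposition.inductionOn 𝒜 with
  | zero => rw [map_zero]; exact Submodule.zero_mem _
  | @homogeneous δ r =>
    rw [← Finsupp.sum_single f, Finsupp.sum, map_sum]
    refine Submodule.sum_mem _ fun γ _ => ?_
    obtain ⟨v', hv', e⟩ := h γ δ r r.2 (f γ) (hf γ)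
    rw [e]
    exact single_mem_famCarrier hv'
  | add r s hr hs => rw [map_add]; exact Submodule.add_mem _ hr hs

/-- The right action on the finitely supported functions with values in the family. -/
abbrev famModule (h : Compatible D 𝒜 φ) : Module Rᵐᵒᵖ (famCarrier D) where
  smul := fun r f => ⟨(φ r.unop).unop f.1, h.map_mem r.unop f.2⟩
  one_smul := fun f => Subtype.ext (by
    change (φ 1).unop f.1 = f.1
    rw [map_one]; rfl)
  mul_smul := fun r s f => Subtype.ext (by
    change (φ (s.unop * r.unop)).unop f.1 = (φ r.unop).unop ((φ s.unop).unop f.1)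
    rw [map_mul]; rfl)
  smul_zero := fun r => Subtype.ext (map_zero (φ r.unop).unop)
  smul_add := fun r f g => Subtype.ext (map_add (φ r.unop).unop f.1 g.1)
  add_smul := fun r s f => Subtype.ext (by
    change (φ (r.unop + s.unop)).unop f.1 = (φ r.unop).unop f.1 + (φ s.unop).unop f.1
    rw [map_add]; rfl)
  zero_smul := fun f => Subtype.ext (by
    change (φ 0).unop f.1 = 0
    rw [map_zero]; rfl)

/-- The graded module with components `D γ` and the given right action. -/
def ofFamily (h : Compatible D 𝒜 φ) : GrMod 𝒜 where
  carrier := famCarrier D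
  moduleRight := famModule h
  isScalarTower := letI := famModule h; ⟨fun c r f => Subtype.ext (by
    change (φ (c • r.unop)).unop f.1 = c • (φ r.unop).unop f.1
    rw [map_smul]; rfl)⟩
  deg γ := (LinearMap.range (Finsupp.lsingle (R := k) γ)).comap (famCarrier D).subtype
  isInternal := by
    let π : Γ → famCarrier D →ₗ[k] famCarrier D := fun γ =>
      (Finsupp.lsingle γ ∘ₗ Finsupp.lapply γ ∘ₗ (famCarrier D).subtype).codRestrict _
        fun f => single_mem_famCarrier (f.2 γ)
    refine isInternal_of_proj _ π ?_ ?_ ?_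
    · rintro γ f ⟨v, hv⟩
      refine Subtype.ext ?_
      change Finsupp.single γ (f.1 γ) = f.1
      rw [show f.1 = Finsupp.single γ v from hv.symm, Finsupp.single_eq_same]
    · rintro γ δ hne f ⟨v, hv⟩
      refine Subtype.ext ?_
      change Finsupp.single γ (f.1 γ) = 0
      rw [show f.1 = Finsupp.single δ v from hv.symm, Finsupp.single_eq_of_ne hne,
        Finsupp.single_zero]
    · rw [eq_top_iff]
      intro f _
      have : f = ∑ γ ∈ f.1.support, ⟨Finsupp.single γ (f.1 γ), single_mem_famCarrier (f.2 γ)⟩ := by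
        apply Subtype.ext
        rw [AddSubmonoidClass.coe_finsetSum]
        exact (Finsupp.sum_single f.1).symm
      rw [this]
      exact Submodule.sum_mem _ fun γ _ => Submodule.mem_iSup_of_mem γ ⟨_, rfl⟩
  smul_mem := by
    rintro γ δ f r ⟨v, hv⟩ hr
    have hf : f.1 = Finsupp.single γ v := hv.symm
    have hv' : v ∈ D γ := by simpa [hf] using f.2 γ
    obtain ⟨v', -, e⟩ := h γ δ r hr v hv'
    refine ⟨v', ?_⟩
    change Finsupp.single (γ + δ) v' = (φ r).unop f.1
    rw [hf, e]

variable (h : Compatible D 𝒜 φ)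

/-- The function underlying an element of a graded module given by a family. -/
def famVal : (ofFamily h).carrier →ₗ[k] Γ →₀ V := (famCarrier D).subtype

theorem famVal_injective : Function.Injective (famVal h) := Subtype.val_injective

theorem famVal_mem (f : (ofFamily h).carrier) (γ : Γ) : famVal h f γ ∈ D γ := f.2 γ

/-- The element of a graded module given by a family that is concentrated in one degree. -/
def famMk (γ : Γ) : D γ →ₗ[k] (ofFamily h).carrier :=
  ((Finsupp.lsingle γ).domRestrict (D γ)).codRestrict (famCarrier D)
    fun v => single_mem_famCarrier v.2

theorem famVal_famMk (γ : Γ) (v : D γ) : famVal h (famMk h γ v) = Finsupp.single γ v.1 := rfl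

theorem famMk_mem (γ : Γ) (v : D γ) : famMk h γ v ∈ (ofFamily h).deg γ := ⟨v.1, rfl⟩

theorem famMk_famVal {γ : Γ} {f : (ofFamily h).carrier} (hf : f ∈ (ofFamily h).deg γ) :
    famMk h γ ⟨famVal h f γ, famVal_mem h f γ⟩ = f := by
  obtain ⟨v, hv⟩ := hf
  have hf : famVal h f = Finsupp.single γ v := hv.symm
  apply famVal_injective
  change Finsupp.single γ (famVal h f γ) = famVal h f
  rw [hf, Finsupp.single_eq_same]

/-- The linear map from a graded module given by a family that is given by linear maps on the
components. -/
def famLift {M : Type u} [AddCommGroup M] [Module k M] (g : Γ → V →ₗ[k] M) :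
    (ofFamily h).carrier →ₗ[k] M :=
  Finsupp.lsum k g ∘ₗ famVal h

theorem famLift_famMk {M : Type u} [AddCommGroup M] [Module k M] (g : Γ → V →ₗ[k] M) (γ : Γ)
    (v : D γ) : famLift h g (famMk h γ v) = g γ v.1 := by
  rw [famLift, LinearMap.comp_apply, famVal_famMk, Finsupp.lsum_single]

/-- The map between graded modules given by families that is induced by a linear map. -/
def famMap {V' : Type u} [AddCommGroup V'] [Module k V'] {D' : Γ → Submodule k V'}
    {φ' : R →ₐ[k] (Module.End k (Γ →₀ V'))ᵐᵒᵖ} (h' : Compatible D' 𝒜 φ') (g : V →ₗ[k] V')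
    (hg : ∀ γ, ∀ v ∈ D γ, g v ∈ D' γ) : (ofFamily h).carrier →ₗ[k] (ofFamily h').carrier :=
  (Finsupp.mapRange.linearMap g ∘ₗ famVal h).codRestrict (famCarrier D')
    fun f γ => hg γ _ (famVal_mem h f γ)

theorem famMap_famMk {V' : Type u} [AddCommGroup V'] [Module k V'] {D' : Γ → Submodule k V'}
    {φ' : R →ₐ[k] (Module.End k (Γ →₀ V'))ᵐᵒᵖ} (h' : Compatible D' 𝒜 φ') (g : V →ₗ[k] V')
    (hg : ∀ γ, ∀ v ∈ D γ, g v ∈ D' γ) (γ : Γ) (v : D γ) :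
    famMap h h' g hg (famMk h γ v) = famMk h' γ ⟨g v.1, hg γ _ v.2⟩ :=
  Subtype.ext (Finsupp.mapRange_single (hf := map_zero g))

end OfFamily

end GrMod

/-! ### Generators of generalized Weyl algebras -/

section Generators

open Polynomial

variable {k : Type u} [Field k] (f : k[X])

theorem adjoin_gen : Algebra.adjoin k (Set.range (gen f)) = ⊤ := by
  have h : Set.range (gen f) = quotMap f '' Set.range (FreeAlgebra.ι k) := by
    rw [← Set.range_comp]; rfl
  rw [h, ← AlgHom.map_adjoin, FreeAlgebra.adjoin_range_ι, Algebra.map_top, AlgHom.range_eq_top]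
  exact RingQuot.mkAlgHom_surjective k (Rel f)

@[elab_as_elim]
theorem gen_induction {motive : A f → Prop} (a : A f) (gen : ∀ g, motive (gen f g))
    (algebraMap : ∀ r : k, motive (algebraMap k (A f) r))
    (add : ∀ a b, motive a → motive b → motive (a + b))
    (mul : ∀ a b, motive a → motive b → motive (a * b)) : motive a := by
  have ha : a ∈ Algebra.adjoin k (Set.range (GWA.gen f)) := by rw [adjoin_gen]; trivial
  induction ha using Algebra.adjoin_induction with
  | mem x hx => obtain ⟨g, rfl⟩ := hx; exact gen g
  | algebraMap r => exact algebraMap r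
  | add a b _ _ ha hb => exact add a b ha hb
  | mul a b _ _ ha hb => exact mul a b ha hb

theorem gen_z : gen f .z = poly f X := (aeval_X (gen f .z)).symm

theorem gen_mul_poly (g : Gen) (p : k[X]) :
    gen f g * poly f p = poly f (p.comp (X + C (g.degree : k))) * gen f g :=
  mul_poly f (gen_mem f g) p

open GrMod in
/-- A `k`-linear map between right modules that commutes with the generators commutes with the
whole algebra. -/
theorem rmul_comm_of_gen {M N : GrMod (grading f)} (Φ : M.carrier →ₗ[k] N.carrier)
    (h : ∀ g m, Φ (M.rmul (gen f g) m) = N.rmul (gen f g) (Φ m)) (a : A f) (m : M.carrier) :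
    Φ (M.rmul a m) = N.rmul a (Φ m) := by
  induction a using gen_induction generalizing m with
  | gen g => exact h g m
  | algebraMap r =>
    rw [Algebra.algebraMap_eq_smul_one, rmul_smul, rmul_smul, rmul_one, rmul_one, map_smul]
  | add a b ha hb => rw [rmul_add, rmul_add, map_add, ha, hb]
  | mul a b ha hb => rw [← rmul_rmul, ← rmul_rmul, hb, ha]

open GrMod in
theorem compatible_of_gen {V : Type u} [AddCommGroup V] [Module k V] {D : ℤ → Submodule k V}
    {φ : A f →ₐ[k] (Module.End k (ℤ →₀ V))ᵐᵒᵖ}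
    (h : ∀ i g, ∀ v ∈ D i, ∃ v' ∈ D (i + g.degree),
      (φ (gen f g)).unop (Finsupp.single i v) = Finsupp.single (i + g.degree) v') :
    Compatible D (grading f) φ := by
  intro i j a ha
  induction ha using Submodule.span_induction with
  | mem a ha =>
    obtain ⟨w, rfl, rfl⟩ := ha
    induction w generalizing i with
    | nil =>
      intro v hv
      refine ⟨v, by simpa using hv, ?_⟩
      simp
    | cons g w ih =>
      intro v hv
      obtain ⟨v', hv', e⟩ := h i g v hv
      obtain ⟨v'', hv'', e'⟩ := ih (i + g.degree) v' hv'
      rw [List.map_cons, List.sum_cons, ← add_assoc, List.map_cons, List.prod_cons, map_mul]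
      refine ⟨v'', hv'', ?_⟩
      rw [← e', ← e]
      rfl
  | zero => exact fun v _ => ⟨0, Submodule.zero_mem _, by simp⟩
  | add a b _ _ iha ihb =>
    intro v hv
    obtain ⟨v', hv', e⟩ := iha v hv
    obtain ⟨v'', hv'', e'⟩ := ihb v hv
    refine ⟨v' + v'', Submodule.add_mem _ hv' hv'', ?_⟩
    rw [map_add, Finsupp.single_add, ← e, ← e']
    rfl
  | smul c a _ iha =>
    intro v hv
    obtain ⟨v', hv', e⟩ := iha v hv
    refine ⟨c • v', Submodule.smul_mem _ c hv', ?_⟩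
    rw [map_smul, ← Finsupp.smul_single, ← e]
    rfl

end Generators

end

section

open Polynomial GrMod

variable {k : Type u} [Field k] [CharZero k]

/-! ### From graded `B`-modules to graded `A`-modules -/

section Restrict

/-- The element of `B` by which a generator of `A` acts on the component of degree `i`. -/
def genEl (k : Type u) [Field k] [CharZero k] : Gen → ℤ → B k
  | .x, i => el (pt i) 1
  | .y, i => el (pt (i - 1)) 1
  | .z, i => el 0 (X + C (i : k))

theorem genEl_mem (g : Gen) (i : ℤ) : genEl k g i ∈ gradB k (seg i + seg (i + g.degree)) := by
  cases g with
  | x =>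
    rw [Gen.degree, ← seg_add_pt, Zfin.add_cancel_left]
    exact el_mem _ _
  | y =>
    rw [Gen.degree, ← sub_eq_add_neg, ← seg_add_pt_sub, Zfin.add_cancel_left]
    exact el_mem _ _
  | z =>
    rw [Gen.degree, add_zero, Zfin.add_self]
    exact el_mem _ _

variable (N : GrMod (gradB k))

/-- The action of the elements of `B_J` on a graded right `B`-module. -/
def act (J : Zfin) : k[X] →ₗ[k] N.carrier →ₗ[k] N.carrier where
  toFun p := N.rmul (el J p)
  map_add' p q := LinearMap.ext fun n => by rw [map_add, rmul_add]; rfl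
  map_smul' c p := LinearMap.ext fun n => by rw [map_smul, rmul_smul]; rfl

theorem rmul_el (J : Zfin) (p : k[X]) : N.rmul (el J p) = act N J p := rfl

theorem act_act (I J : Zfin) (p q : k[X]) (n : N.carrier) :
    act N J q (act N I p n) = act N (I + J) (hpoly k (I * J) * (p * q)) n := by
  rw [← rmul_el, ← rmul_el, ← rmul_el, rmul_rmul, el_mul_el]

theorem act_zero_one (n : N.carrier) : act N 0 1 n = n := by
  rw [← rmul_el, el_zero_one, rmul_one]

theorem act_mem {I : Zfin} (J : Zfin) (p : k[X]) {n : N.carrier} (hn : n ∈ N.deg I) :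
    act N J p n ∈ N.deg (I + J) := N.rmul_mem hn (el_mem J p)

theorem act_zero_act (J : Zfin) (p q : k[X]) (n : N.carrier) :
    act N 0 q (act N J p n) = act N J (p * q) n := by
  rw [act_act, mul_zero, hpoly_zero, one_mul, add_zero]

theorem act_act_zero (J : Zfin) (p q : k[X]) (n : N.carrier) :
    act N J q (act N 0 p n) = act N J (p * q) n := by
  rw [act_act, zero_mul, hpoly_zero, one_mul, zero_add]

theorem act_pt_act_pt (i : ℤ) (n : N.carrier) :
    act N (pt i) 1 (act N (pt i) 1 n) = act N 0 ((X + C (i : k)) * (X + C (i : k))) n := by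
  rw [act_act, Zfin.add_self, Zfin.mul_self, hpoly_pt, mul_one, mul_one, pow_two (X + C (i : k))]

/-- The operator by which a generator of `A` acts on finitely supported functions with values in a
`B`-module. -/
def genOp (g : Gen) : Module.End k (ℤ →₀ N.carrier) :=
  Finsupp.lsum k fun i => Finsupp.lsingle (i + g.degree) ∘ₗ N.rmul (genEl k g i)

theorem genOp_x (i : ℤ) (n : N.carrier) :
    genOp N .x (Finsupp.single i n) = Finsupp.single (i + 1) (act N (pt i) 1 n) := by
  simp [genOp, Gen.degree, genEl, rmul_el]

theorem genOp_y (i : ℤ) (n : N.carrier) :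
    genOp N .y (Finsupp.single i n) = Finsupp.single (i - 1) (act N (pt (i - 1)) 1 n) := by
  simp [genOp, Gen.degree, genEl, rmul_el, sub_eq_add_neg]

theorem genOp_z (i : ℤ) (n : N.carrier) :
    genOp N .z (Finsupp.single i n) = Finsupp.single i (act N 0 (X + C (i : k)) n) := by
  simp only [genOp, Gen.degree, genEl, rmul_el, Finsupp.lsum_single, LinearMap.comp_apply,
    add_zero, Finsupp.lsingle_apply]

theorem genOp_z_sub (i : ℤ) (n : N.carrier) :
    genOp N .z (Finsupp.single i n) - Finsupp.single i n =
      Finsupp.single i (act N 0 (X + C ((i - 1 : ℤ) : k)) n) := by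
  rw [genOp_z, ← Finsupp.single_sub, Int.cast_sub, map_sub, ← add_sub_assoc, map_sub,
    Int.cast_one, map_one, LinearMap.sub_apply, act_zero_one]

theorem genOp_z_add (i : ℤ) (n : N.carrier) :
    genOp N .z (Finsupp.single i n) + Finsupp.single i n =
      Finsupp.single i (act N 0 (X + C ((i + 1 : ℤ) : k)) n) := by
  rw [genOp_z, ← Finsupp.single_add, Int.cast_add, C_add, ← add_assoc, Int.cast_one, C_1,
    map_add (act N 0) _ 1, LinearMap.add_apply _ (act N 0 1), act_zero_one]

omit [CharZero k] in
theorem aeval_X_sq {S : Type u} [Ring S] [Algebra k S] (a : S) :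
    aeval a (X ^ 2 : k[X]) = a * a := by
  rw [map_pow, aeval_X, pow_two]

theorem genOp_xz : genOp N .z * genOp N .x = genOp N .x * (genOp N .z + 1) :=
  Finsupp.lhom_ext fun i n => by
    change genOp N .z (genOp N .x _) = genOp N .x (genOp N .z _ + Finsupp.single i n)
    rw [genOp_z_add, genOp_x, genOp_x, genOp_z, act_zero_act, act_act_zero, mul_comm]

theorem genOp_yz : genOp N .z * genOp N .y = genOp N .y * (genOp N .z - 1) :=
  Finsupp.lhom_ext fun i n => by
    change genOp N .z (genOp N .y _) = genOp N .y (genOp N .z _ - Finsupp.single i n)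
    rw [genOp_z_sub, genOp_y, genOp_y, genOp_z, act_zero_act, act_act_zero, mul_comm]

theorem genOp_xy : genOp N .y * genOp N .x = genOp N .z * genOp N .z :=
  Finsupp.lhom_ext fun i n => by
    change genOp N .y (genOp N .x _) = genOp N .z (genOp N .z _)
    rw [genOp_x, genOp_y, genOp_z, genOp_z, add_sub_cancel_right, act_pt_act_pt, act_zero_act]

theorem genOp_yx : genOp N .x * genOp N .y = (genOp N .z - 1) * (genOp N .z - 1) :=
  Finsupp.lhom_ext fun i n => by
    have h : ∀ w, (genOp N .z - 1) w = genOp N .z w - w := fun _ => rfl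
    rw [Module.End.mul_apply, Module.End.mul_apply, h (Finsupp.single i n), genOp_z_sub, h,
      genOp_z_sub, genOp_y, genOp_x, sub_add_cancel, act_pt_act_pt, act_zero_act]

/-- The right action of `A` on finitely supported functions with values in a `B`-module. -/
def restrRep : A (X ^ 2 : k[X]) →ₐ[k] (Module.End k (ℤ →₀ N.carrier))ᵐᵒᵖ :=
  liftA (X ^ 2) (fun g => MulOpposite.op (genOp N g))
    (congrArg MulOpposite.op (genOp_xz N)) (congrArg MulOpposite.op (genOp_yz N))
    ((congrArg MulOpposite.op (genOp_xy N)).trans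
      (aeval_X_sq (k := k) (MulOpposite.op (genOp N .z))).symm)
    ((congrArg MulOpposite.op (genOp_yx N)).trans
      (aeval_X_sq (k := k) (MulOpposite.op (genOp N .z) - 1)).symm)

theorem restrRep_gen_single (g : Gen) (i : ℤ) (n : N.carrier) :
    (restrRep N (gen (X ^ 2) g)).unop (Finsupp.single i n) =
      Finsupp.single (i + g.degree) (N.rmul (genEl k g i) n) := by
  rw [restrRep, liftA_gen, MulOpposite.unop_op]
  simp [genOp]

theorem restr_compatible : Compatible (fun i => N.deg (seg i)) (gradA k) (restrRep N) :=
  compatible_of_gen _ fun i g v hv => by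
    refine ⟨N.rmul (genEl k g i) v, ?_, restrRep_gen_single N g i v⟩
    have := N.rmul_mem hv (genEl_mem g i)
    rwa [Zfin.add_cancel_left] at this

/-- The graded `A`-module with components `N_{[0, i)}`, for a graded `B`-module `N`. -/
def restr : GrMod (gradA k) := ofFamily (restr_compatible N)

/-- The element of `restr N` given by an element of a component of `N`. -/
def restrMk (i : ℤ) : N.deg (seg i) →ₗ[k] (restr N).carrier := famMk (restr_compatible N) i

theorem restrMk_mem {i : ℤ} (n : N.deg (seg i)) : restrMk N i n ∈ (restr N).deg i :=
  famMk_mem (restr_compatible N) i n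

variable {N} in
theorem restrMk_congr {i j : ℤ} (h : i = j) {n : N.deg (seg i)} {m : N.deg (seg j)}
    (h' : n.1 = m.1) : restrMk N i n = restrMk N j m := by
  subst h
  congr 1
  exact Subtype.ext h'

theorem mem_deg_seg_add {i : ℤ} {J : Zfin} {r : B k} {n : N.carrier} (hn : n ∈ N.deg (seg i))
    {j : ℤ} (hr : r ∈ gradB k J) (h : seg i + J = seg j) : N.rmul r n ∈ N.deg (seg j) :=
  h ▸ N.rmul_mem hn hr

variable {N} in
theorem restrMk_injective (i : ℤ) : Function.Injective (restrMk N i) := fun n m h => by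
  have : Finsupp.single i n.1 = Finsupp.single i m.1 :=
    congrArg (famVal (restr_compatible N)) h
  exact Subtype.ext (Finsupp.single_injective i this)

variable {N} in
theorem exists_restrMk {i : ℤ} {f : (restr N).carrier} (hf : f ∈ (restr N).deg i) :
    ∃ n, restrMk N i n = f := ⟨_, famMk_famVal (restr_compatible N) hf⟩

/-- The components of an element of `restr N`. -/
def restrVal (i : ℤ) : (restr N).carrier →ₗ[k] N.carrier :=
  Finsupp.lapply i ∘ₗ famVal (restr_compatible N)

theorem restrVal_mem (i : ℤ) (f : (restr N).carrier) : restrVal N i f ∈ N.deg (seg i) :=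
  famVal_mem (restr_compatible N) f i

theorem restrVal_restrMk_same {i : ℤ} (n : N.deg (seg i)) : restrVal N i (restrMk N i n) = n.1 :=
  Finsupp.single_eq_same

theorem restrVal_restrMk_ne {i j : ℤ} (h : j ≠ i) (n : N.deg (seg i)) :
    restrVal N j (restrMk N i n) = 0 :=
  Finsupp.single_eq_of_ne h

/-- The linear map from `restr N` given by linear maps on the components of `N`. -/
def restrLift {M : Type u} [AddCommGroup M] [Module k M] (g : ℤ → N.carrier →ₗ[k] M) :
    (restr N).carrier →ₗ[k] M := famLift (restr_compatible N) g

theorem restrLift_restrMk {M : Type u} [AddCommGroup M] [Module k M] (g : ℤ → N.carrier →ₗ[k] M)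
    {i : ℤ} (n : N.deg (seg i)) : restrLift N g (restrMk N i n) = g i n.1 :=
  famLift_famMk (restr_compatible N) g i n

variable {N} in
/-- The map between the graded `A`-modules of two `B`-modules that is induced by a morphism. -/
def restrMapBase {N' : GrMod (gradB k)} (Φ : N ⟶ N') : (restr N).carrier →ₗ[k] (restr N').carrier :=
  famMap (restr_compatible N) (restr_compatible N') (toLinBase Φ) fun _ _ hn => toLin_mem Φ hn

theorem restrMapBase_restrMk {N' : GrMod (gradB k)} (Φ : N ⟶ N') {i : ℤ} (n : N.deg (seg i)) :
    restrMapBase Φ (restrMk N i n) = restrMk N' i ⟨toLin Φ n.1, toLin_mem Φ n.2⟩ :=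
  famMap_famMk (restr_compatible N) (restr_compatible N') (toLinBase Φ)
    (fun _ _ hn => toLin_mem Φ hn) i n

theorem restr_rmul_gen (g : Gen) {i : ℤ} (n : N.deg (seg i)) :
    (restr N).rmul (gen (X ^ 2) g) (restrMk N i n) = restrMk N (i + g.degree)
      ⟨N.rmul (genEl k g i) n.1,
        mem_deg_seg_add N n.2 (genEl_mem g i) (Zfin.add_cancel_left _ _)⟩ :=
  famVal_injective (restr_compatible N) (restrRep_gen_single N g i n.1)

attribute [irreducible] restr restrMk restrVal restrLift restrMapBase

variable {N} in
@[elab_as_elim]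
theorem restrMk_induction {motive : (restr N).carrier → Prop} (f : (restr N).carrier)
    (mk : ∀ i n, motive (restrMk N i n)) (add : ∀ f g, motive f → motive g → motive (f + g)) :
    motive f := by
  induction f using homogeneous_induction with
  | mem i f hf =>
    obtain ⟨n, rfl⟩ := exists_restrMk hf
    exact mk i n
  | add f g hf hg => exact add f g hf hg

omit [CharZero k] in
theorem poly_C (f : k[X]) (r : k) : poly f (C r) = r • 1 :=
  ((poly f).commutes r).trans (Algebra.algebraMap_eq_smul_one r)

omit [CharZero k] in
theorem poly_mul_X (f p : k[X]) : poly f (p * X) = poly f p * gen f .z := by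
  rw [gen_z, ← map_mul]

omit [CharZero k] in
theorem mon_zero (f : k[X]) : mon f (Int.ofNat 0) = 1 := pow_zero _

omit [CharZero k] in
theorem mon_negSucc_zero (f : k[X]) : mon f (Int.negSucc 0) = gen f .y := pow_one _

set_option maxHeartbeats 1000000 in
theorem restr_rmul_poly (p : k[X]) {i : ℤ} (n : N.deg (seg i)) :
    (restr N).rmul (poly (X ^ 2) p) (restrMk N i n) = restrMk N i
      ⟨act N 0 (p.comp (X + C (i : k))) n.1,
        mem_deg_seg_add N n.2 (el_mem _ _) (add_zero _)⟩ := by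
  induction p using Polynomial.induction_on generalizing n with
  | C r =>
    have h' : (C r : k[X]) = r • 1 := Algebra.algebraMap_eq_smul_one r
    rw [poly_C, rmul_smul, rmul_one, ← map_smul]
    refine restrMk_congr rfl ?_
    dsimp only
    rw [C_comp, h', map_smul, LinearMap.smul_apply, act_zero_one]
    rfl
  | add p q hp hq =>
    rw [map_add, rmul_add, hp, hq, ← map_add]
    refine restrMk_congr rfl ?_
    dsimp only
    rw [add_comp, map_add, LinearMap.add_apply]
    rfl
  | monomial m r ih =>
    have h : (C r * X ^ (m + 1) : k[X]) = C r * X ^ m * X := by rw [mul_assoc, ← pow_succ]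
    rw [h, poly_mul_X (X ^ 2 : k[X]) (C r * X ^ m), ← rmul_rmul, ih, restr_rmul_gen N .z]
    refine restrMk_congr (i := i + Gen.z.degree) (j := i) (add_zero i) ?_
    simp only [genEl, rmul_el]
    rw [act_zero_act, mul_comp (C r * X ^ m), X_comp]

omit [CharZero k] in
theorem mon_ofNat_succ (f : k[X]) (d : ℕ) :
    mon f (Int.ofNat (d + 1)) = mon f (Int.ofNat d) * gen f .x := pow_succ _ _

omit [CharZero k] in
theorem mon_negSucc_succ (f : k[X]) (d : ℕ) :
    mon f (Int.negSucc (d + 1)) = mon f (Int.negSucc d) * gen f .y := pow_succ _ _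

set_option maxHeartbeats 1000000 in
theorem restr_rmul_mon (d : ℤ) {i : ℤ} (n : N.deg (seg i)) :
    (restr N).rmul (mon (X ^ 2) d) (restrMk N i n) = restrMk N (i + d)
      ⟨act N (seg i + seg (i + d)) 1 n.1,
        mem_deg_seg_add N n.2 (el_mem _ _) (Zfin.add_cancel_left _ _)⟩ := by
  have hx : ∀ d : ℤ, 0 ≤ d → act N (pt (i + d)) 1 (act N (seg i + seg (i + d)) 1 n.1) =
      act N (seg i + seg (i + d + 1)) 1 n.1 := fun d hd => by
    rw [act_act, seg_add_seg_mul_pt (by omega), hpoly_zero, one_mul, one_mul, add_assoc,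
      seg_add_pt]
  have hy : ∀ d : ℤ, d ≤ 0 → act N (pt (i + d - 1)) 1 (act N (seg i + seg (i + d)) 1 n.1) =
      act N (seg i + seg (i + d - 1)) 1 n.1 := fun d hd => by
    have h : (seg i + seg (i + d)) * pt (i + d - 1) = 0 :=
      Zfin.eq_zero fun m => by
        simp only [mem_mul_iff, mem_add_iff, mem_seg, mem_pt]; omega
    rw [act_act, h, hpoly_zero, one_mul, one_mul, add_assoc, seg_add_pt_sub]
  have h0 : act N (seg i + seg (i + 0)) 1 n.1 = n.1 := by
    rw [add_zero, Zfin.add_self, act_zero_one]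
  rcases d with d | d
  · induction d with
    | zero =>
      rw [mon_zero, rmul_one]
      exact restrMk_congr (add_zero i).symm h0.symm
    | succ d ih =>
      rw [mon_ofNat_succ, ← rmul_rmul, ih, restr_rmul_gen N .x]
      refine restrMk_congr (show i + Int.ofNat d + Gen.x.degree = i + Int.ofNat (d + 1) from
        add_assoc i (d : ℤ) 1) ?_
      exact (hx d (by positivity)).trans (by rw [add_assoc]; rfl)
  · induction d with
    | zero =>
      rw [mon_negSucc_zero, restr_rmul_gen N .y n]
      refine restrMk_congr (i := i + Gen.y.degree) (j := i + Int.negSucc 0) rfl ?_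
      have := hy 0 le_rfl
      rw [h0, add_zero, sub_eq_add_neg] at this
      exact this
    | succ d ih =>
      rw [mon_negSucc_succ, ← rmul_rmul, ih, restr_rmul_gen N .y]
      refine restrMk_congr (show i + Int.negSucc d + Gen.y.degree = i + Int.negSucc (d + 1) from
        add_assoc i (Int.negSucc d) (-1)) ?_
      exact (hy (Int.negSucc d) (Int.negSucc_lt_zero d).le).trans (by
        rw [sub_eq_add_neg, add_assoc]; rfl)

end Restrict

end

section

namespace GrMod

variable {k : Type u} [Field k] {Γ : Type} [AddCommGroup Γ] [DecidableEq Γ]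
  {R : Type u} [Ring R] [Algebra k R] {𝒜 : Γ → Submodule k R}

theorem proj_rmul (M : GrMod 𝒜) (γ : Γ) {δ : Γ} {r : R} (hr : r ∈ 𝒜 δ) (m : M.carrier) :
    M.proj (γ + δ) (M.rmul r m) = M.rmul r (M.proj γ m) := by
  induction m using homogeneous_induction with
  | mem ε m hm =>
    by_cases h : γ = ε
    · subst h
      rw [M.proj_same hm, M.proj_same (M.rmul_mem hm hr)]
    · rw [M.proj_ne h hm, M.proj_ne (fun e => h (add_right_cancel e)) (M.rmul_mem hm hr), map_zero]
  | add m n hm hn => rw [map_add, map_add, map_add, map_add, hm, hn]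

theorem rmul_mem_submodule {M : GrMod 𝒜} (H : Submodule Rᵐᵒᵖ M.carrier) (r : R) {m : M.carrier}
    (hm : m ∈ H) : M.rmul r m ∈ H := H.smul_mem _ hm

theorem rmul_mem_submodule' {M : GrMod 𝒜} (H : Submodule Rᵐᵒᵖ M.carrier) (r : R) {m n : M.carrier}
    (hm : m ∈ H) (h : M.rmul r m = n) : n ∈ H := h ▸ rmul_mem_submodule H r hm

theorem exists_homogeneous_generators (M : GrMod 𝒜) (h : Module.Finite Rᵐᵒᵖ M.carrier) :
    ∃ (ι : Type u) (_ : Finite ι) (γ : ι → Γ) (m : ι → M.carrier),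
      (∀ t, m t ∈ M.deg (γ t)) ∧ Submodule.span Rᵐᵒᵖ (Set.range m) = ⊤ := by
  classical
  obtain ⟨S, hS⟩ := h.fg_top
  choose s hs using M.exists_sum_proj
  let T : Finset M.carrier := S.biUnion fun m => (s m).image fun γ => M.proj γ m
  have hT : ∀ t : T, ∃ γ, t.1 ∈ M.deg γ := by
    rintro ⟨t, ht⟩
    obtain ⟨m, -, ht⟩ := Finset.mem_biUnion.1 ht
    obtain ⟨γ, -, rfl⟩ := Finset.mem_image.1 ht
    exact ⟨γ, M.proj_mem γ m⟩
  choose γ hγ using hT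
  refine ⟨T, inferInstance, γ, Subtype.val, hγ, ?_⟩
  rw [eq_top_iff, ← hS, Submodule.span_le]
  intro m hm
  rw [SetLike.mem_coe, ← hs m]
  refine Submodule.sum_mem _ fun γ hγ => Submodule.subset_span ⟨⟨_, ?_⟩, rfl⟩
  exact Finset.mem_biUnion.2 ⟨m, hm, Finset.mem_image_of_mem _ hγ⟩

theorem finite_of_span {M : GrMod 𝒜} {ι : Type u} [Finite ι] (m : ι → M.carrier)
    (h : ∀ γ, ∀ n ∈ M.deg γ, n ∈ Submodule.span Rᵐᵒᵖ (Set.range m)) :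
    Module.Finite Rᵐᵒᵖ M.carrier := by
  refine ⟨?_⟩
  have : (⊤ : Submodule Rᵐᵒᵖ M.carrier) = Submodule.span Rᵐᵒᵖ (Set.range m) := by
    refine (eq_top_iff.2 fun n _ => ?_).symm
    induction n using homogeneous_induction with
    | mem γ n hn => exact h γ n hn
    | add n n' hn hn' => exact Submodule.add_mem _ (hn trivial) (hn' trivial)
  rw [this]
  exact Submodule.fg_span (Set.finite_range m)

end GrMod

open Polynomial GrMod

variable {k : Type u} [Field k] [CharZero k]

section Functor

variable (N : GrMod (gradB k))

theorem act_segs (J : Zfin) (a i : ℤ) (p : k[X]) (n : N.carrier) :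
    act N (J + seg i) 1 (act N (J + seg a) p n) =
      act N (seg a + seg i) (hpoly k ((J + seg a) * (J + seg i)) * p) n := by
  rw [act_act, mul_one, add_comm J (seg a), add_assoc, Zfin.add_cancel_left]

theorem act_comm (J K : Zfin) (i : ℤ) (p : k[X]) (n : N.carrier) :
    act N (J + seg i) 1 (act N K p n) =
      act N 0 (hpoly k (K * (J + seg i)) * p) (act N (J + K + seg i) 1 n) := by
  rw [act_act, act_zero_act, mul_one, one_mul, ← add_assoc, add_comm K J]

theorem act_decomp {J : Zfin} {a b : ℤ} {p q : k[X]}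
    (h : p * hpoly k (J + seg a) + q * hpoly k (J + seg b) = 1) (n : N.carrier) :
    act N (J + seg a) p (act N (J + seg a) 1 n) + act N (J + seg b) q (act N (J + seg b) 1 n) =
      n := by
  rw [act_act, act_act, Zfin.add_self, Zfin.add_self, Zfin.mul_self, Zfin.mul_self, one_mul,
    one_mul, ← LinearMap.add_apply, ← map_add, mul_comm, mul_comm _ q, h, act_zero_one]

variable {N} in
theorem act_seg_mem {J : Zfin} {n : N.carrier} (hn : n ∈ N.deg J) (i : ℤ) (p : k[X]) :
    act N (J + seg i) p n ∈ N.deg (seg i) := by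
  have := act_mem N (J + seg i) p hn
  rwa [Zfin.add_cancel_left] at this

theorem eq_of_act_seg (J : Zfin) {n n' : N.carrier}
    (h : ∀ i, act N (J + seg i) 1 n = act N (J + seg i) 1 n') : n = n' := by
  obtain ⟨a, b, p, q, hpq⟩ := exists_isCoprime_seg k J
  rw [← act_decomp N hpq n, h, h, act_decomp N hpq]

/-- The element of `A` that acts on `restr N` as the elements of `B` of degree `[i, j)`. -/
def path (i j : ℤ) (p : k[X]) : A (X ^ 2 : k[X]) :=
  mon (X ^ 2) (j - i) * poly (X ^ 2) (p.comp (X - C (j : k)))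

theorem restr_rmul_path {i j : ℤ} (p : k[X]) (n : N.deg (seg i)) :
    (restr N).rmul (path i j p) (restrMk N i n) = restrMk N j
      ⟨act N (seg i + seg j) p n.1,
        mem_deg_seg_add N n.2 (el_mem _ _) (Zfin.add_cancel_left _ _)⟩ := by
  have h : i + (j - i) = j := by ring
  rw [path, ← rmul_rmul, restr_rmul_mon, restr_rmul_poly]
  refine restrMk_congr h ?_
  dsimp only
  rw [act_zero_act, one_mul, h, comp_assoc]
  simp

theorem restrVal_rmul_gen (g : Gen) (i : ℤ) (f : (restr N).carrier) :
    restrVal N (i + g.degree) ((restr N).rmul (gen (X ^ 2) g) f) =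
      N.rmul (genEl k g i) (restrVal N i f) := by
  induction f using restrMk_induction with
  | mk j n =>
    rw [restr_rmul_gen N g n]
    by_cases h : i = j
    · subst h
      rw [restrVal_restrMk_same, restrVal_restrMk_same]
    · rw [restrVal_restrMk_ne N h, restrVal_restrMk_ne N (fun e => h (add_right_cancel e)),
        map_zero]
  | add f f' hf hf' => rw [map_add, map_add, map_add, map_add, hf, hf']

variable {N} {N' : GrMod (gradB k)}

/-- The morphism of graded `A`-modules induced by a morphism of graded `B`-modules. -/
def restrMap (Φ : N ⟶ N') : restr N ⟶ restr N' :=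
  ofBase (restrMapBase Φ)
    (rmul_comm_of_gen _ _ fun g f => by
      induction f using restrMk_induction with
      | mk i n =>
        rw [restr_rmul_gen N g n, restrMapBase_restrMk, restrMapBase_restrMk, restr_rmul_gen N' g]
        exact restrMk_congr rfl (toLin_rmul Φ _ n.1)
      | add f f' hf hf' => rw [map_add, map_add, map_add, map_add, hf, hf'])
    fun i f hf => by
      obtain ⟨n, rfl⟩ := exists_restrMk hf
      rw [restrMapBase_restrMk]
      exact restrMk_mem _ _

theorem restrMap_restrMk (Φ : N ⟶ N') {i : ℤ} (n : N.deg (seg i)) :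
    toLin (restrMap Φ) (restrMk N i n) = restrMk N' i ⟨toLin Φ n.1, toLin_mem Φ n.2⟩ :=
  restrMapBase_restrMk N Φ n

theorem restr_hom_ext {M : GrMod (gradA k)} {φ ψ : restr N ⟶ M}
    (h : ∀ i n, toLin φ (restrMk N i n) = toLin ψ (restrMk N i n)) : φ = ψ := by
  ext f
  induction f using restrMk_induction with
  | mk i n => exact h i n
  | add f f' hf hf' => rw [map_add, map_add, hf, hf']

variable (k) in
/-- The functor that takes a graded `B`-module to the graded `A`-module with components
`N_{[0, i)}`. -/
def restrFunctor : GrMod (gradB k) ⥤ GrMod (gradA k) where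
  obj N := restr N
  map Φ := restrMap Φ
  map_id N := restr_hom_ext fun i n => by
    rw [restrMap_restrMk]; rfl
  map_comp Φ Ψ := restr_hom_ext fun i n => by
    rw [toLin_comp, restrMap_restrMk, restrMap_restrMk, restrMap_restrMk]; rfl

instance : (restrFunctor k).Additive where
  map_add {_ _ Φ Ψ} := restr_hom_ext fun i n => by
    change toLin (restrMap (Φ + Ψ)) _ = toLin (restrMap Φ) _ + toLin (restrMap Ψ) _
    rw [restrMap_restrMk, restrMap_restrMk, restrMap_restrMk, ← map_add]; rfl

instance : (restrFunctor k).Linear k where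
  map_smul Φ c := restr_hom_ext fun i n => by
    change toLin (restrMap (c • Φ)) _ = c • toLin (restrMap Φ) _
    rw [restrMap_restrMk, restrMap_restrMk, ← map_smul]; rfl

instance : (restrFunctor k).Faithful where
  map_injective {N N' Φ Ψ} h := by
    have key : ∀ i, ∀ n ∈ N.deg (seg i), toLin Φ n = toLin Ψ n := fun i n hn => by
      have : toLin (restrMap Φ) (restrMk N i ⟨n, hn⟩) = toLin (restrMap Ψ) (restrMk N i ⟨n, hn⟩) :=
        congrArg (fun θ : restr N ⟶ restr N' => toLin θ (restrMk N i ⟨n, hn⟩)) h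
      rw [restrMap_restrMk, restrMap_restrMk] at this
      exact congrArg Subtype.val (restrMk_injective i this)
    ext n
    induction n using homogeneous_induction with
    | mem J n hn =>
      refine eq_of_act_seg N' J fun i => ?_
      rw [← rmul_el, ← toLin_rmul, ← toLin_rmul, rmul_el]
      exact key i _ (act_seg_mem hn i 1)
    | add n n' hn hn' => rw [map_add, map_add, hn, hn']

end Functor

section Full

variable {N N' : GrMod (gradB k)} (ψ : restr N ⟶ restr N')

/-- The component of degree `i` of a morphism of graded `A`-modules `restr N ⟶ restr N'`. -/
def restrComp (i : ℤ) : N.carrier →ₗ[k] N'.carrier :=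
  restrVal N' i ∘ₗ toLinBase ψ ∘ₗ restrMk N i ∘ₗ
    (N.proj (seg i)).codRestrict (N.deg (seg i)) (N.proj_mem (seg i))

theorem restrComp_mem (i : ℤ) (n : N.carrier) : restrComp ψ i n ∈ N'.deg (seg i) :=
  restrVal_mem N' i _

theorem toLin_restrMk {i : ℤ} (n : N.deg (seg i)) :
    toLin ψ (restrMk N i n) = restrMk N' i ⟨restrComp ψ i n.1, restrComp_mem ψ i n.1⟩ := by
  obtain ⟨n', h⟩ := exists_restrMk (toLin_mem ψ (restrMk_mem N n))
  rw [← h]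
  refine restrMk_congr rfl ?_
  have e : (N.proj (seg i)).codRestrict (N.deg (seg i)) (N.proj_mem (seg i)) n.1 = n :=
    Subtype.ext (N.proj_same n.2)
  change n'.1 = restrVal N' i (toLin ψ (restrMk N i _))
  rw [e, ← h, restrVal_restrMk_same]

theorem restrComp_act {i j : ℤ} (p : k[X]) {n : N.carrier} (hn : n ∈ N.deg (seg i)) :
    restrComp ψ j (act N (seg i + seg j) p n) = act N' (seg i + seg j) p (restrComp ψ i n) := by
  have h := toLin_rmul ψ (path i j p) (restrMk N i ⟨n, hn⟩)
  rw [restr_rmul_path, toLin_restrMk, toLin_restrMk, restr_rmul_path] at h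
  exact congrArg Subtype.val (restrMk_injective j h)

theorem restrComp_act_zero {i : ℤ} (p : k[X]) {n : N.carrier} (hn : n ∈ N.deg (seg i)) :
    restrComp ψ i (act N 0 p n) = act N' 0 p (restrComp ψ i n) := by
  have := restrComp_act ψ (j := i) p hn
  rwa [Zfin.add_self] at this

theorem exists_extension (J : Zfin) : ∃ g : N.carrier →ₗ[k] N'.carrier, ∀ n ∈ N.deg J,
    g n ∈ N'.deg J ∧
      ∀ i, act N' (J + seg i) 1 (g n) = restrComp ψ i (act N (J + seg i) 1 n) := by
  obtain ⟨a, b, p, q, hpq⟩ := exists_isCoprime_seg k J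
  refine ⟨act N' (J + seg a) p ∘ₗ restrComp ψ a ∘ₗ act N (J + seg a) 1 +
    act N' (J + seg b) q ∘ₗ restrComp ψ b ∘ₗ act N (J + seg b) 1, fun n hn => ⟨?_, fun i => ?_⟩⟩
  · have key : ∀ a p, act N' (J + seg a) p (restrComp ψ a (act N (J + seg a) 1 n)) ∈ N'.deg J := by
      intro a p
      have := act_mem N' (J + seg a) p (restrComp_mem ψ a (act N (J + seg a) 1 n))
      rwa [add_comm J, Zfin.add_cancel_left, add_comm] at this
    exact Submodule.add_mem _ (key a p) (key b q)
  · have key : ∀ a p, act N' (J + seg i) 1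
        (act N' (J + seg a) p (restrComp ψ a (act N (J + seg a) 1 n))) =
        restrComp ψ i (act N (J + seg i) 1 (act N (J + seg a) p (act N (J + seg a) 1 n))) := by
      intro a p
      rw [act_segs, act_segs N J a i p, restrComp_act ψ _ (act_seg_mem hn a 1)]
    change act N' (J + seg i) 1 (_ + _) = _
    conv_rhs => rw [← act_decomp N hpq n]
    rw [map_add, map_add, map_add]
    exact congrArg₂ _ (key a p) (key b q)

theorem exists_restrMap : ∃ Φ : N ⟶ N', restrMap Φ = ψ := by
  choose g hg hg' using exists_extension ψ
  obtain ⟨Φ, hΦ⟩ := N.exists_linearMap g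
  have hmem : ∀ J, ∀ n ∈ N.deg J, Φ n ∈ N'.deg J := fun J n hn => by
    rw [hΦ J n hn]; exact hg J n hn
  have hact : ∀ J, ∀ n ∈ N.deg J, ∀ i,
      act N' (J + seg i) 1 (Φ n) = restrComp ψ i (act N (J + seg i) 1 n) := fun J n hn => by
    rw [hΦ J n hn]; exact hg' J n hn
  have hlin : ∀ b n, Φ (N.rmul b n) = N'.rmul b (Φ n) := by
    intro b n
    induction b using el_induction with
    | el K p =>
      induction n using homogeneous_induction with
      | mem J n hn =>
        rw [rmul_el, rmul_el]
        refine eq_of_act_seg N' (J + K) fun i => ?_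
        have e : J + K + K = J := by rw [add_assoc, Zfin.add_self, add_zero]
        rw [hact _ _ (act_mem N K p hn), act_comm, act_comm, e,
          restrComp_act_zero ψ _ (act_seg_mem hn i 1), hact J n hn]
      | add n n' hn hn' => rw [map_add, map_add, map_add, map_add, hn, hn']
    | add b c hb hc => rw [rmul_add, rmul_add, map_add, hb, hc]
  refine ⟨ofBase Φ hlin hmem, restr_hom_ext fun i n => ?_⟩
  rw [restrMap_restrMk, toLin_restrMk]
  refine restrMk_congr rfl ?_
  have := hact _ _ n.2 i
  rwa [Zfin.add_self, act_zero_one, act_zero_one] at this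

instance : (restrFunctor k).Full where
  map_surjective ψ := exists_restrMap ψ

end Full

section Finite

variable (N : GrMod (gradB k))

theorem finite_of_restr (h : Module.Finite (A (X ^ 2 : k[X]))ᵐᵒᵖ (restr N).carrier) :
    Module.Finite (B k)ᵐᵒᵖ N.carrier := by
  obtain ⟨ι, _, γ, m, hm, hspan⟩ := exists_homogeneous_generators _ h
  let n : ι → N.carrier := fun t => restrVal N (γ t) (m t)
  have hn : ∀ t, n t ∈ Submodule.span (B k)ᵐᵒᵖ (Set.range n) := fun t =>
    Submodule.subset_span ⟨t, rfl⟩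
  have hgen : ∀ a : A (X ^ 2 : k[X]), ∀ f,
      (∀ i, restrVal N i f ∈ Submodule.span (B k)ᵐᵒᵖ (Set.range n)) →
      ∀ i, restrVal N i ((restr N).rmul a f) ∈ Submodule.span (B k)ᵐᵒᵖ (Set.range n) := by
    intro a
    induction a using gen_induction with
    | gen g =>
      intro f hf i
      have := restrVal_rmul_gen N g (i - g.degree) f
      rw [sub_add_cancel] at this
      rw [this]
      exact rmul_mem_submodule _ _ (hf _)
    | algebraMap r =>
      intro f hf i
      rw [Algebra.algebraMap_eq_smul_one, rmul_smul, rmul_one, map_smul]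
      exact Submodule.smul_of_tower_mem _ r (hf i)
    | add a b ha hb =>
      intro f hf i
      rw [rmul_add, map_add]
      exact Submodule.add_mem _ (ha f hf i) (hb f hf i)
    | mul a b ha hb =>
      intro f hf i
      rw [← rmul_rmul]
      exact hb _ (ha f hf) i
  have hval : ∀ f i, restrVal N i f ∈ Submodule.span (B k)ᵐᵒᵖ (Set.range n) := by
    intro f
    have hf : f ∈ Submodule.span (A (X ^ 2 : k[X]))ᵐᵒᵖ (Set.range m) := by rw [hspan]; trivial
    induction hf using Submodule.span_induction with
    | mem f hf =>
      obtain ⟨t, rfl⟩ := hf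
      intro i
      by_cases h : i = γ t
      · subst h; exact hn t
      · obtain ⟨n', h'⟩ := exists_restrMk (hm t)
        rw [← h', restrVal_restrMk_ne N h]
        exact Submodule.zero_mem _
    | zero => intro i; rw [map_zero]; exact Submodule.zero_mem _
    | add f f' _ _ hf hf' => intro i; rw [map_add]; exact Submodule.add_mem _ (hf i) (hf' i)
    | smul a f _ hf => exact hgen a.unop f hf
  refine finite_of_span n fun J v hv => ?_
  obtain ⟨a, b, p, q, hpq⟩ := exists_isCoprime_seg k J
  have key : ∀ a p, act N (J + seg a) p (act N (J + seg a) 1 v) ∈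
      Submodule.span (B k)ᵐᵒᵖ (Set.range n) := fun a p => by
    have := hval (restrMk N a ⟨_, act_seg_mem hv a 1⟩) a
    rw [restrVal_restrMk_same] at this
    exact rmul_mem_submodule _ (el (J + seg a) p) this
  rw [← act_decomp N hpq v]
  exact Submodule.add_mem _ (key a p) (key b q)

set_option maxHeartbeats 1000000 in
theorem restr_finite (h : Module.Finite (B k)ᵐᵒᵖ N.carrier) :
    Module.Finite (A (X ^ 2 : k[X]))ᵐᵒᵖ (restr N).carrier := by
  obtain ⟨ι, _, γ, m, hm, hspan⟩ := exists_homogeneous_generators _ h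
  choose a b p q hpq using exists_isCoprime_seg k
  let f : ι ⊕ ι → (restr N).carrier := Sum.elim
    (fun t => restrMk N (a (γ t)) ⟨_, act_seg_mem (hm t) (a (γ t)) 1⟩)
    (fun t => restrMk N (b (γ t)) ⟨_, act_seg_mem (hm t) (b (γ t)) 1⟩)
  have hf : ∀ s, f s ∈ Submodule.span (A (X ^ 2 : k[X]))ᵐᵒᵖ (Set.range f) := fun s =>
    Submodule.subset_span ⟨s, rfl⟩
  have hval : ∀ n J i, restrMk N i ⟨_, act_seg_mem (N.proj_mem J n) i 1⟩ ∈
      Submodule.span (A (X ^ 2 : k[X]))ᵐᵒᵖ (Set.range f) := by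
    intro n
    have hn : n ∈ Submodule.span (B k)ᵐᵒᵖ (Set.range m) := by rw [hspan]; trivial
    induction hn using Submodule.span_induction with
    | mem n hn =>
      obtain ⟨t, rfl⟩ := hn
      intro J i
      by_cases h : J = γ t
      · have h1 := rmul_mem_submodule _
          (path (a (γ t)) i (hpoly k ((γ t + seg (a (γ t))) * (γ t + seg i)) * p (γ t)))
          (hf (.inl t))
        have h2 := rmul_mem_submodule _
          (path (b (γ t)) i (hpoly k ((γ t + seg (b (γ t))) * (γ t + seg i)) * q (γ t)))
          (hf (.inr t))
        have h3 := Submodule.add_mem _ h1 h2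
        change (restr N).rmul _ (restrMk N _ _) + (restr N).rmul _ (restrMk N _ _) ∈ _ at h3
        rw [restr_rmul_path, restr_rmul_path, ← map_add] at h3
        refine (restrMk_congr rfl ?_ : restrMk N i _ = restrMk N i _) ▸ h3
        change act N _ _ (act N _ _ _) + act N _ _ (act N _ _ _) = act N _ _ (N.proj J (m t))
        rw [← act_segs, ← act_segs, ← map_add, act_decomp N (hpq (γ t)), h, N.proj_same (hm t)]
      · have : restrMk N i ⟨_, act_seg_mem (N.proj_mem J (m t)) i 1⟩ = restrMk N i 0 :=
          restrMk_congr rfl (by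
            dsimp only
            rw [N.proj_ne h (hm t), map_zero]; rfl)
        rw [this, map_zero]
        exact Submodule.zero_mem _
    | zero =>
      intro J i
      have : restrMk N i ⟨_, act_seg_mem (N.proj_mem J 0) i 1⟩ = restrMk N i 0 :=
        restrMk_congr rfl (by
          dsimp only
          rw [map_zero, map_zero]; rfl)
      rw [this, map_zero]
      exact Submodule.zero_mem _
    | add n n' _ _ hn hn' =>
      intro J i
      refine (?_ : restrMk N i _ + restrMk N i _ = restrMk N i _) ▸
        Submodule.add_mem _ (hn J i) (hn' J i)
      rw [← map_add]
      refine restrMk_congr rfl ?_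
      dsimp only
      rw [map_add, map_add]
      rfl
    | smul r n _ hn =>
      obtain ⟨r, rfl⟩ := MulOpposite.op_surjective r
      intro J i
      change restrMk N i ⟨act N (J + seg i) 1 (N.proj J (N.rmul r n)), _⟩ ∈ _
      induction r using el_induction with
      | el K c =>
        refine rmul_mem_submodule' _
          (poly (X ^ 2) ((hpoly k (K * (J + seg i)) * c).comp (X - C (i : k)))) (hn (J + K) i) ?_
        rw [restr_rmul_poly]
        refine restrMk_congr rfl ?_
        dsimp only
        have e : J + K + K = J := by rw [add_assoc, Zfin.add_self, add_zero]
        have h := N.proj_rmul (J + K) (el_mem K c) n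
        rw [e] at h
        rw [h, rmul_el, act_comm, comp_assoc]
        simp
      | add r s hr hs =>
        refine (?_ : restrMk N i _ + restrMk N i _ = restrMk N i _) ▸ Submodule.add_mem _ hr hs
        rw [← map_add]
        refine restrMk_congr rfl ?_
        dsimp only
        rw [rmul_add, map_add, map_add]
        rfl
  refine finite_of_span f fun i v hv => ?_
  obtain ⟨n, rfl⟩ := exists_restrMk hv
  refine (restrMk_congr rfl ?_ : restrMk N i _ = restrMk N i n) ▸ hval n.1 (seg i) i
  dsimp only
  rw [Zfin.add_self, act_zero_one, N.proj_same n.2]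

end Finite

end

section

open Polynomial GrMod

variable {k : Type u} [Field k]

/-! ### From graded `A`-modules to graded `B`-modules -/

section Coinduce

theorem mon_add_one (f : k[X]) {d : ℤ} (hd : 0 ≤ d) : mon f (d + 1) = mon f d * gen f .x := by
  obtain ⟨n, rfl⟩ := Int.eq_ofNat_of_zero_le hd
  exact mon_ofNat_succ f n

theorem mon_add_one_mul_y (f : k[X]) {d : ℤ} (hd : d < 0) :
    mon f (d + 1) * gen f .y = mon f d := by
  obtain ⟨n, rfl⟩ := Int.eq_negSucc_of_lt_zero hd
  cases n with
  | zero =>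
    rw [mon_negSucc_zero, show Int.negSucc 0 + 1 = Int.ofNat 0 from rfl, mon_zero, one_mul]
  | succ n =>
    rw [show Int.negSucc (n + 1) + 1 = Int.negSucc n from rfl]
    exact (mon_negSucc_succ f n).symm

theorem mon_mem (f : k[X]) (d : ℤ) : mon f d ∈ grading f d := by
  rcases d with d | d
  · have := SetLike.pow_mem_graded d (gen_mem f .x)
    rwa [show d • Gen.x.degree = Int.ofNat d by simp [Gen.degree]] at this
  · have := SetLike.pow_mem_graded (d + 1) (gen_mem f .y)
    rwa [show (d + 1) • Gen.y.degree = Int.negSucc d by simp [Gen.degree]; omega] at this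

theorem hpoly_cocycle (K L s : Zfin) : hpoly k (K * (K + L)) * hpoly k (L * s) =
    hpoly k ((L + K) * s) * hpoly k (K * (K + (L + s))) := by
  have := hpoly_assoc (k := k) K (K + L) s
  rw [Zfin.add_cancel_left, add_assoc] at this
  rw [add_comm L K, this]

variable (M : GrMod (gradA k))

/-- The action of `k[z]` on a right `A`-module, shifted so that in degree `i` it commutes with the
action of the homogeneous elements. -/
def zact (i : ℤ) : k[X] →ₗ[k] M.carrier →ₗ[k] M.carrier where
  toFun p := M.rmul (poly (X ^ 2) (p.comp (X - C (i : k))))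
  map_add' p q := LinearMap.ext fun m => by rw [add_comp, map_add, rmul_add]; rfl
  map_smul' c p := LinearMap.ext fun m => by rw [smul_comp, map_smul, rmul_smul]; rfl

theorem zact_apply (i : ℤ) (p : k[X]) (m : M.carrier) :
    zact M i p m = M.rmul (poly (X ^ 2) (p.comp (X - C (i : k)))) m := rfl

theorem zact_zact (i : ℤ) (p q : k[X]) (m : M.carrier) :
    zact M i q (zact M i p m) = zact M i (p * q) m := by
  rw [zact_apply, zact_apply, zact_apply, rmul_rmul, ← map_mul, mul_comp]

theorem zact_one (i : ℤ) (m : M.carrier) : zact M i 1 m = m := by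
  rw [zact_apply, one_comp, map_one, rmul_one]

theorem zact_mem {i j : ℤ} (p : k[X]) {m : M.carrier} (hm : m ∈ M.deg j) :
    zact M i p m ∈ M.deg j := by
  have := M.rmul_mem hm (poly_mem (X ^ 2) (p.comp (X - C (i : k))))
  rwa [add_zero] at this

theorem rmul_x_zact (i : ℤ) (p : k[X]) (m : M.carrier) :
    M.rmul (gen (X ^ 2) .x) (zact M i p m) = zact M (i + 1) p (M.rmul (gen (X ^ 2) .x) m) := by
  have h := gen_mul_poly (X ^ 2 : k[X]) .x (p.comp (X - C ((i + 1 : ℤ) : k)))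
  rw [zact_apply, zact_apply, rmul_rmul, rmul_rmul, h, comp_assoc]
  simp [Gen.degree]

theorem rmul_y_zact (i : ℤ) (p : k[X]) (m : M.carrier) :
    M.rmul (gen (X ^ 2) .y) (zact M (i + 1) p m) = zact M i p (M.rmul (gen (X ^ 2) .y) m) := by
  have h := gen_mul_poly (X ^ 2 : k[X]) .y (p.comp (X - C (i : k)))
  have e : (X : k[X]) - C ((i + 1 : ℤ) : k) = X + -1 - C (i : k) := by
    push_cast; rw [C_add, C_1]; ring
  rw [zact_apply, zact_apply, rmul_rmul, rmul_rmul, h, comp_assoc, e]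
  simp [Gen.degree]

theorem rmul_y_rmul_x (i : ℤ) (m : M.carrier) :
    M.rmul (gen (X ^ 2) .y) (M.rmul (gen (X ^ 2) .x) m) = zact M i (hpoly k (pt i)) m := by
  have h : (hpoly k (pt i)).comp (X - C (i : k)) = X ^ 2 := by rw [hpoly_pt]; simp
  rw [zact_apply, h, rmul_rmul, gen_xy]
  rfl

theorem rmul_x_rmul_y (i : ℤ) (m : M.carrier) :
    M.rmul (gen (X ^ 2) .x) (M.rmul (gen (X ^ 2) .y) m) = zact M (i + 1) (hpoly k (pt i)) m := by
  have h : (hpoly k (pt i)).comp (X - C ((i + 1 : ℤ) : k)) = (X - 1) ^ 2 := by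
    rw [hpoly_pt]; simp; ring
  have h' : poly (X ^ 2 : k[X]) ((X - 1) ^ 2) = aeval (gen (X ^ 2 : k[X]) .z - 1) (X ^ 2 : k[X]) := by
    simp [poly]
  rw [zact_apply, h, rmul_rmul, gen_yx, h']

/-- The families `(m_i)` with `m_i ∈ M_i` that correspond to morphisms from the rank one projective
module `ι_J A` to `M`. -/
def coindFam (J : Zfin) : Submodule k (ℤ → M.carrier) where
  carrier := {m | ∀ i, m i ∈ M.deg i ∧
    M.rmul (gen (X ^ 2) .x) (m i) = zact M (i + 1) (hpoly k ((J + seg i) * pt i)) (m (i + 1)) ∧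
    M.rmul (gen (X ^ 2) .y) (m (i + 1)) = zact M i (hpoly k ((J + seg (i + 1)) * pt i)) (m i)}
  add_mem' {m n} hm hn i := by
    refine ⟨Submodule.add_mem _ (hm i).1 (hn i).1, ?_, ?_⟩
    · rw [Pi.add_apply, Pi.add_apply, map_add, map_add, (hm i).2.1, (hn i).2.1]
    · rw [Pi.add_apply, Pi.add_apply, map_add, map_add, (hm i).2.2, (hn i).2.2]
  zero_mem' i := by
    refine ⟨Submodule.zero_mem _, ?_, ?_⟩ <;> rw [Pi.zero_apply, Pi.zero_apply, map_zero, map_zero]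
  smul_mem' c m hm i := by
    refine ⟨Submodule.smul_mem _ c (hm i).1, ?_, ?_⟩
    · rw [Pi.smul_apply, Pi.smul_apply, map_smul, map_smul, (hm i).2.1]
    · rw [Pi.smul_apply, Pi.smul_apply, map_smul, map_smul, (hm i).2.2]

/-- The action of the elements of degree `K` of `B` on families of elements of `M`, as a map from
families in degree `J` to families in degree `J + K`. -/
def coindAct (J K : Zfin) : k[X] →ₗ[k] Module.End k (ℤ → M.carrier) where
  toFun p := LinearMap.pi fun i => zact M i (hpoly k (K * (K + (J + seg i))) * p) ∘ₗ LinearMap.proj i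
  map_add' p q := LinearMap.ext fun m => funext fun i => by
    change zact M i (_ * (p + q)) (m i) = zact M i (_ * p) (m i) + zact M i (_ * q) (m i)
    rw [mul_add, map_add]; rfl
  map_smul' c p := LinearMap.ext fun m => funext fun i => by
    change zact M i (_ * c • p) (m i) = c • zact M i (_ * p) (m i)
    rw [mul_smul_comm, map_smul]; rfl

theorem coindAct_apply (J K : Zfin) (p : k[X]) (m : ℤ → M.carrier) (i : ℤ) :
    coindAct M J K p m i = zact M i (hpoly k (K * (K + (J + seg i))) * p) (m i) := rfl

theorem coindAct_mem (J K : Zfin) (p : k[X]) {m : ℤ → M.carrier} (hm : m ∈ coindFam M J) :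
    coindAct M J K p m ∈ coindFam M (J + K) := by
  have e1 : ∀ i, J + K + seg i = J + seg i + K := fun i => add_right_comm J K (seg i)
  have e2 : ∀ i, J + seg i + pt i = J + seg (i + 1) := fun i => by rw [add_assoc, seg_add_pt]
  have e3 : ∀ i, J + seg (i + 1) + pt i = J + seg i := fun i => by
    rw [← e2, add_assoc, Zfin.add_self, add_zero]
  intro i
  simp only [coindAct_apply]
  obtain ⟨h1, h2, h3⟩ := hm i
  refine ⟨zact_mem M _ h1, ?_, ?_⟩
  · rw [rmul_x_zact, h2, zact_zact, zact_zact, e1]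
    congr 2
    have := hpoly_cocycle (k := k) K (J + seg i) (pt i)
    rw [e2] at this
    linear_combination p * this
  · rw [rmul_y_zact, h3, zact_zact, zact_zact, e1]
    congr 2
    have := hpoly_cocycle (k := k) K (J + seg (i + 1)) (pt i)
    rw [e3] at this
    linear_combination p * this

theorem coindAct_coindAct (L I J : Zfin) (p q : k[X]) (m : ℤ → M.carrier) :
    coindAct M (L + I) J q (coindAct M L I p m) =
      coindAct M L (I + J) (hpoly k (I * J) * (p * q)) m := by
  funext i
  rw [coindAct_apply, coindAct_apply, coindAct_apply, zact_zact]
  congr 2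
  have h := hpoly_assoc (k := k) I J (I + J + (L + seg i))
  have e : J + (I + J + (L + seg i)) = I + (L + seg i) := by
    rw [add_assoc, add_left_comm, Zfin.add_cancel_left]
  have e' : I + J + (L + seg i) = J + (L + I + seg i) := by abel
  rw [e] at h
  rw [← e']
  linear_combination (-(p * q)) * h

/-- The operator by which the elements of degree `K` of `B` act on finitely supported functions with
values in families of elements of `M`. -/
def coindOp (K : Zfin) : k[X] →ₗ[k] Module.End k (Zfin →₀ (ℤ → M.carrier)) where
  toFun p := Finsupp.lsum k fun J => Finsupp.lsingle (J + K) ∘ₗ coindAct M J K p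
  map_add' p q := Finsupp.lhom_ext fun J m => by
    rw [LinearMap.add_apply, Finsupp.lsum_single, Finsupp.lsum_single, Finsupp.lsum_single,
      map_add, LinearMap.comp_add]
    rfl
  map_smul' c p := Finsupp.lhom_ext fun J m => by
    rw [LinearMap.smul_apply, Finsupp.lsum_single, Finsupp.lsum_single, map_smul,
      LinearMap.comp_smul]
    rfl

theorem coindOp_single (J K : Zfin) (p : k[X]) (m : ℤ → M.carrier) :
    coindOp M K p (Finsupp.single J m) = Finsupp.single (J + K) (coindAct M J K p m) := by
  change Finsupp.lsum k _ _ = _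
  rw [Finsupp.lsum_single]
  rfl

theorem coindOp_zero_one : coindOp M 0 1 = 1 :=
  Finsupp.lhom_ext fun J m => by
    rw [coindOp_single, add_zero]
    congr 1
    funext i
    rw [coindAct_apply, zero_mul, hpoly_zero, mul_one, zact_one]

theorem coindOp_mul (I J : Zfin) (p q : k[X]) :
    coindOp M (I + J) (hpoly k (I * J) * (p * q)) = coindOp M J q * coindOp M I p :=
  Finsupp.lhom_ext fun L m => by
    rw [Module.End.mul_apply, coindOp_single, coindOp_single, coindOp_single, coindAct_coindAct,
      add_assoc]

variable [CharZero k]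

/-- The right action of `B_K` on finitely supported functions with values in families of elements
of `M`. -/
def coindRepOn (K : Zfin) : BComp k K →ₗ[k] (Module.End k (Zfin →₀ (ℤ → M.carrier)))ᵐᵒᵖ :=
  (MulOpposite.opLinearEquiv k).toLinearMap ∘ₗ coindOp M K ∘ₗ coef K

theorem coindRepOn_one : coindRepOn M 0 GradedMonoid.GOne.one = 1 :=
  congrArg MulOpposite.op ((congrArg (coindOp M 0) coef_oneB).trans (coindOp_zero_one M))

theorem coindRepOn_mul {I J : Zfin} (a : BComp k I) (b : BComp k J) :
    coindRepOn M (I + J) (GradedMonoid.GMul.mul a b) = coindRepOn M I a * coindRepOn M J b :=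
  congrArg MulOpposite.op
    ((congrArg (coindOp M (I + J)) (coef_mulB a b)).trans (coindOp_mul M I J _ _))

/-- The right action of `B` on finitely supported functions with values in families of elements
of `M`. -/
def coindRep : B k →ₐ[k] (Module.End k (Zfin →₀ (ℤ → M.carrier)))ᵐᵒᵖ :=
  DirectSum.toAlgebra k (BComp k) (coindRepOn M) (coindRepOn_one M) (coindRepOn_mul M)

theorem coindRep_el (K : Zfin) (p : k[X]) :
    (coindRep M (el K p)).unop = coindOp M K p := by
  obtain ⟨a, rfl⟩ := coef_surjective K p
  rw [el_coef]
  exact congrArg MulOpposite.unop (DirectSum.toSemiring_of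
    (fun K => (coindRepOn M K).toAddMonoidHom) (coindRepOn_one M) (coindRepOn_mul M) K a)

theorem coind_compatible : Compatible (coindFam M) (gradB k) (coindRep M) := by
  intro J K b hb m hm
  obtain ⟨p, rfl⟩ := exists_el hb
  exact ⟨_, coindAct_mem M J K p hm, by rw [coindRep_el, coindOp_single]⟩

/-- The graded `B`-module with components `Hom_{gr A}(ι_J A, M)`. -/
def coind : GrMod (gradB k) := ofFamily (coind_compatible M)

/-- The element of `coind M` given by a family of elements of `M`. -/
def coindMk (J : Zfin) : coindFam M J →ₗ[k] (coind M).carrier := famMk (coind_compatible M) J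

/-- The entries of the families in an element of `coind M`. -/
def coindVal (J : Zfin) (i : ℤ) : (coind M).carrier →ₗ[k] M.carrier :=
  LinearMap.proj i ∘ₗ Finsupp.lapply J ∘ₗ famVal (coind_compatible M)

theorem coindMk_mem {J : Zfin} (m : coindFam M J) : coindMk M J m ∈ (coind M).deg J :=
  famMk_mem (coind_compatible M) J m

theorem coindVal_coindMk {J : Zfin} (m : coindFam M J) (i : ℤ) :
    coindVal M J i (coindMk M J m) = m.1 i :=
  congrFun (Finsupp.single_eq_same (a := J) (b := m.1)) i

theorem coindVal_mem (J : Zfin) (i : ℤ) (f : (coind M).carrier) : coindVal M J i f ∈ M.deg i :=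
  (famVal_mem (coind_compatible M) f J i).1

theorem rmul_x_coindVal (J : Zfin) (i : ℤ) (f : (coind M).carrier) :
    M.rmul (gen (X ^ 2) .x) (coindVal M J i f) =
      zact M (i + 1) (hpoly k ((J + seg i) * pt i)) (coindVal M J (i + 1) f) :=
  (famVal_mem (coind_compatible M) f J i).2.1

theorem rmul_y_coindVal (J : Zfin) (i : ℤ) (f : (coind M).carrier) :
    M.rmul (gen (X ^ 2) .y) (coindVal M J (i + 1) f) =
      zact M i (hpoly k ((J + seg (i + 1)) * pt i)) (coindVal M J i f) :=
  (famVal_mem (coind_compatible M) f J i).2.2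

theorem eq_zero_of_coindVal {J : Zfin} {f : (coind M).carrier} (hf : f ∈ (coind M).deg J)
    (h : ∀ i, coindVal M J i f = 0) : f = 0 := by
  have h' : famVal (coind_compatible M) f J = 0 := funext h
  exact (famMk_famVal (coind_compatible M) hf).symm.trans
    ((congrArg (famMk (coind_compatible M) J) (Subtype.ext h')).trans
      (map_zero (famMk (coind_compatible M) J)))

theorem coindVal_act (J K : Zfin) (i : ℤ) (p : k[X]) {f : (coind M).carrier}
    (hf : f ∈ (coind M).deg J) : coindVal M (J + K) i (act (coind M) K p f) =
      zact M i (hpoly k (K * (K + (J + seg i))) * p) (coindVal M J i f) := by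
  obtain ⟨m, rfl⟩ : ∃ m, coindMk M J m = f := ⟨_, famMk_famVal (coind_compatible M) hf⟩
  rw [coindVal_coindMk]
  change (coindRep M (el K p)).unop (Finsupp.single J m.1) (J + K) i = _
  rw [coindRep_el, coindOp_single, Finsupp.single_eq_same, coindAct_apply]

attribute [irreducible] coind coindMk coindVal

end Coinduce

section Counit

variable [CharZero k] (M : GrMod (gradA k))

/-- The linear map underlying the isomorphism of `restr (coind M)` with `M`. -/
def counitBase : (restr (coind M)).carrier →ₗ[k] M.carrier :=
  restrLift (coind M) fun i => coindVal M (seg i) i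

theorem counitBase_restrMk {i : ℤ} (n : (coind M).deg (seg i)) :
    counitBase M (restrMk (coind M) i n) = coindVal M (seg i) i n.1 :=
  restrLift_restrMk _ _ _

theorem coindVal_congr {I J : Zfin} {i j : ℤ} (h : I = J) (h' : i = j) (f : (coind M).carrier) :
    coindVal M I i f = coindVal M J j f := by rw [h, h']

theorem counitBase_rmul (g : Gen) (f : (restr (coind M)).carrier) :
    counitBase M ((restr (coind M)).rmul (gen (X ^ 2) g) f) =
      M.rmul (gen (X ^ 2) g) (counitBase M f) := by
  induction f using restrMk_induction with
  | mk i n =>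
    rw [restr_rmul_gen _ g n, counitBase_restrMk, counitBase_restrMk]
    dsimp only
    cases g with
    | x =>
      have h1 := coindVal_act M (seg i) (pt i) (i + 1) 1 n.2
      rw [← seg_add_pt, Zfin.add_cancel_left, Zfin.add_self, mul_zero, hpoly_zero, mul_one,
        zact_one] at h1
      have h2 := rmul_x_coindVal M (seg i) i n.1
      rw [Zfin.add_self, zero_mul, hpoly_zero, zact_one] at h2
      rw [h2, ← h1]
      exact coindVal_congr M (seg_add_pt i).symm rfl _
    | y =>
      have h1 := coindVal_act M (seg i) (pt (i - 1)) (i - 1) 1 n.2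
      rw [← seg_add_pt_sub, Zfin.add_cancel_left, Zfin.add_self, mul_zero, hpoly_zero, mul_one,
        zact_one] at h1
      have h2 := rmul_y_coindVal M (seg i) (i - 1) n.1
      rw [sub_add_cancel, Zfin.add_self, zero_mul, hpoly_zero, zact_one] at h2
      rw [h2, ← h1]
      exact coindVal_congr M (seg_add_pt_sub i).symm rfl _
    | z =>
      have h1 := coindVal_act M (seg i) 0 i (X + C (i : k)) n.2
      rw [zero_mul, hpoly_zero, one_mul, add_zero, zact_apply] at h1
      have e : (X + C (i : k)).comp (X - C (i : k)) = X := by simp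
      rw [e, ← gen_z] at h1
      rw [← h1]
      exact coindVal_congr M (by rw [Gen.degree, add_zero]) (add_zero i) _
  | add f f' hf hf' => rw [map_add, map_add, map_add, map_add, hf, hf']

/-- The natural morphism `restr (coind M) ⟶ M`. -/
def counit : restr (coind M) ⟶ M :=
  ofBase (counitBase M) (rmul_comm_of_gen _ _ (counitBase_rmul M)) fun i f hf => by
    obtain ⟨n, rfl⟩ := exists_restrMk hf
    rw [counitBase_restrMk]
    exact coindVal_mem M _ _ _

theorem counit_injective : Function.Injective (toLin (counit M)) := by
  refine toLin_injective _ fun i f hf h => ?_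
  obtain ⟨n, rfl⟩ := exists_restrMk hf
  have h0 : coindVal M (seg i) i n.1 = 0 := (counitBase_restrMk M n).symm.trans h
  have key : ∀ j, coindVal M (seg i) j n.1 = 0 := by
    intro j
    rcases le_total i j with hj | hj
    · induction j, hj using Int.leInduction with
      | base => exact h0
      | succ j hj ih =>
        have := rmul_x_coindVal M (seg i) j n.1
        rwa [seg_add_seg_mul_pt hj, hpoly_zero, zact_one, ih, map_zero, eq_comm] at this
    · induction j, hj using Int.leInductionDown with
      | base => exact h0
      | pred j hj ih =>
        have := rmul_y_coindVal M (seg i) (j - 1) n.1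
        have e : (seg i + seg j) * pt (j - 1) = 0 := Zfin.eq_zero fun m => by
          simp only [mem_mul_iff, mem_add_iff, mem_seg, mem_pt]; omega
        rwa [sub_add_cancel, e, hpoly_zero, zact_one, ih, map_zero, eq_comm] at this
  have : n = 0 := Subtype.ext (eq_zero_of_coindVal M n.2 key)
  rw [this, map_zero]

omit [CharZero k] in
theorem mon_mem_coindFam {i : ℤ} {m : M.carrier} (hm : m ∈ M.deg i) :
    (fun j => M.rmul (mon (X ^ 2) (j - i)) m) ∈ coindFam M (seg i) := by
  intro j
  dsimp only
  have e : j + 1 - i = j - i + 1 := by ring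
  refine ⟨?_, ?_, ?_⟩
  · have := M.rmul_mem hm (mon_mem (X ^ 2) (j - i))
    rwa [add_sub_cancel] at this
  · rcases le_or_gt i j with h | h
    · rw [seg_add_seg_mul_pt h, hpoly_zero, zact_one, e, mon_add_one _ (sub_nonneg.2 h), rmul_rmul]
    · rw [seg_add_seg_mul_pt_of_lt h, ← rmul_x_rmul_y, e, rmul_rmul M (mon (X ^ 2) (j - i + 1)),
        mon_add_one_mul_y _ (sub_neg.2 h)]
  · rcases le_or_gt i j with h | h
    · have e' : (seg i + seg (j + 1)) * pt j = pt j := Zfin.ext_mem fun m => by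
        simp only [mem_mul_iff, mem_add_iff, mem_seg, mem_pt]; omega
      rw [e', ← rmul_y_rmul_x, e, rmul_rmul M (mon (X ^ 2) (j - i)),
        mon_add_one _ (sub_nonneg.2 h)]
    · have e' : (seg i + seg (j + 1)) * pt j = 0 := Zfin.eq_zero fun m => by
        simp only [mem_mul_iff, mem_add_iff, mem_seg, mem_pt]; omega
      rw [e', hpoly_zero, zact_one, e, rmul_rmul, mon_add_one_mul_y _ (sub_neg.2 h)]

theorem counit_surjective : Function.Surjective (toLin (counit M)) := by
  refine toLin_surjective _ fun i m hm => ?_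
  refine ⟨restrMk _ i ⟨coindMk M (seg i) ⟨_, mon_mem_coindFam M hm⟩, coindMk_mem M _⟩, ?_⟩
  refine (counitBase_restrMk M _).trans ?_
  rw [coindVal_coindMk]
  dsimp only
  rw [sub_self, show mon (X ^ 2 : k[X]) 0 = 1 from mon_zero _, rmul_one]

instance : IsIso (counit M) := isIso_of_bijective _ ⟨counit_injective M, counit_surjective M⟩

instance : (restrFunctor k).EssSurj where
  mem_essImage M := by
    have e : restr (coind M) ≅ M := asIso (counit M)
    exact ⟨coind M, ⟨e⟩⟩

end Counit

/-! ### The equivalence -/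

section Equivalence

variable (k) [CharZero k]

instance : (restrFunctor k).IsEquivalence where

theorem inverseImage_finitelyGenerated :
    (finitelyGenerated (gradA k)).inverseImage (restrFunctor k) = finitelyGenerated (gradB k) := by
  ext N
  exact ⟨finite_of_restr N, restr_finite N⟩

instance : (finitelyGenerated (gradA k)).IsClosedUnderIsomorphisms where
  of_iso {M N} e h := by
    have : Module.Finite (A (X ^ 2 : k[X]))ᵐᵒᵖ M.carrier := h
    refine Module.Finite.of_surjective (toLin e.hom) fun n => ⟨toLin e.inv n, ?_⟩
    rw [← toLin_comp, e.inv_hom_id, toLin_id]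

/-- The equivalence between finitely generated graded modules over `B` and over `A`. -/
def grEquiv : Gr (gradB k) ≌ Gr (gradA k) :=
  (restrFunctor k).asEquivalence.congrFullSubcategory (inverseImage_finitelyGenerated k)

instance : (grEquiv k).functor.Additive where
  map_add := ObjectProperty.hom_ext _ ((restrFunctor k).map_add)

instance : (grEquiv k).functor.Linear k where
  map_smul _ c := ObjectProperty.hom_ext _ ((restrFunctor k).map_smul c _)

end Equivalence

end

end GWA

end

/-- For `f = z²` over an algebraically closed field `k` of characteristic zero, there is a `k`-linear
equivalence between `gr A(f)`, the finitely generated `ℤ`-graded right `A(f)`-modules, and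
`gr (B, ℤ_fin)`, the finitely generated `ℤ_fin`-graded right modules over
`B = ⨁_J Hom_{gr A}(A, ι_J A)`. -/
theorem theorem4p3 (k : Type u) [Field k] [IsAlgClosed k] [CharZero k] :
    ∃ F : GWA.Gr (GWA.grading (Polynomial.X ^ 2 : Polynomial k)) ≌ GWA.Gr (GWA.gradB k),
      F.functor.Additive ∧ F.functor.Linear k := by
  have h : (GWA.grEquiv k).inverse.Additive := inferInstance
  exact ⟨(GWA.grEquiv k).symm, h, Equivalence.inverseLinear k (GWA.grEquiv k)⟩
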